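/- Let $H$ be a complex separable infinite-dimensional Hilbert space with a fixed orthonormal basis $\{e_k\}_{k\ge 1}$, let $\mathscr D\subset B(H)$ be the algebra of operators that are diagonal with respect to this basis, and let $E:B(H)\to\mathscr D$ be the conditional expectation that sends $T$ to the diagonal operator with the same main diagonal. Let $K(H)^+$ be the set of positive compact operators, $\mathscr L_1$ the trace class, and $\operatorname{tr}$ the trace, with values in $[0,\infty]$ on positive operators. For $T\in B(H)$ let $R_T$ be the orthogonal projection onto $\overline{\operatorname{ran}T}$, $R_T^\perp=I-R_T$, and $$\mathscr U(T)=\{UTU^*\mid U \text{ unitary}\},\qquad \mathscr V(T)=\{VTV^*\mid V\text{ a partial isometry with } V^*V=R_T\vee R_{T^*}\}.$$ For compact $T$ let $s(T)=(s_j(T))_{j\ge1}$ be its sequence of singular numbers: the nonzero eigenvalues of $|T|=(T^*T)^{1/2}$ in nonincreasing order, repeated according to multiplicity, followed by infinitely many zeros if $T$ has finite rank. For nonincreasing nonnegative sequences $\xi,\eta$ converging to $0$, write $\xi\prec\eta$ if $\sum_{j=1}^n\xi_j\le\sum_{j=1}^n\eta_j$ for every $n$, and $\xi\preccurlyeq\eta$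 if moreover $\liminf_{n}\sum_{j=1}^n(\eta_j-\xi_j)=0$. **Proposition 6.6.** Let $A\in K(H)^+$. Then (i) $E(\mathscr U(A))\subseteq E(\mathscr V(A))\cap\{B\in\mathscr D\mid \operatorname{tr}(R_B^\perp)\le\operatorname{tr}(R_A^\perp)\}.$ (ii) If $R_A=I$, then $$E(\mathscr U(A))=E(\mathscr V(A))\cap\{B\in\mathscr D\mid R_B=I\}=\begin{cases}\{B\in\mathscr D\cap K(H)^+\mid s(B)\prec s(A),\ R_B=I\}\setminus\mathscr L_1&\text{if }\operatorname{tr}(A)=\infty,\\ \{B\in\mathscr D\cap K(H)^+\mid s(B)\preccurlyeq s(A),\ R_B=I\}&\text{if }\operatorname{tr}(A)<\infty.\end{cases}$$ (iii) The inclusion in (i) is proper if and only if $R_A\ne I$ and $A$ has infinite rank. -/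

import Mathlib

open scoped ENNReal

namespace SchurHorn

noncomputable section

section Sequences

/-- Majorization `ξ ≺ η` of (nonincreasing) real sequences, indexed from `0`. -/
def Majorizes (ξ η : ℕ → ℝ) : Prop :=
  ∀ n : ℕ, ∑ j ∈ Finset.range n, ξ j ≤ ∑ j ∈ Finset.range n, η j

/-- Strong majorization `ξ ≼ η`: majorization together with `liminf ∑_{j<n} (η j - ξ j) = 0`.
The lower limit is taken in the extended reals. -/
def StronglyMajorizes (ξ η : ℕ → ℝ) : Prop :=
  Majorizes ξ η ∧
    Filter.liminf (fun n : ℕ => ((∑ j ∈ Finset.range n, (η j - ξ j) : ℝ) : EReal))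
      Filter.atTop = 0

end Sequences

section Operators

variable {H : Type*} [NormedAddCommGroup H] [InnerProductSpace ℂ H] [CompleteSpace H]

/-- The range projection `R_A`: the orthogonal projection onto the closure of the range of `A`. -/
def rangeProj (A : H →L[ℂ] H) : H →L[ℂ] H :=
  (LinearMap.range (A : H →ₗ[ℂ] H)).topologicalClosure.starProjection

/-- The projection `R_A ∨ R_{A*}`: the orthogonal projection onto the closed linear span of the
ranges of `A` and `A*`. -/
def supportProj (A : H →L[ℂ] H) : H →L[ℂ] H :=
  (LinearMap.range (A : H →ₗ[ℂ] H) ⊔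
    LinearMap.range ((star A : H →L[ℂ] H) : H →ₗ[ℂ] H)).topologicalClosure.starProjection

/-- The unitary orbit of `A`. -/
def unitaryOrbit (A : H →L[ℂ] H) : Set (H →L[ℂ] H) :=
  {B | ∃ U ∈ unitary (H →L[ℂ] H), B = U * A * star U}

/-- The partial isometry orbit of `A`: all `V A V*` with `V` a partial isometry whose initial
projection `V* V` is `R_A ∨ R_{A*}`. -/
def partialIsometryOrbit (A : H →L[ℂ] H) : Set (H →L[ℂ] H) :=
  {B | ∃ V : H →L[ℂ] H, V * star V * V = V ∧ star V * V = supportProj A ∧ B = V * A * star V}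

/-- The sequence of s-numbers of a compact operator `A`: `sNumbers A n` is the `(n+1)`-st largest
eigenvalue of `|A|`, counted with multiplicity, and it is `0` if `|A|` has at most `n` nonzero
eigenvalues. Concretely it is the largest `t > 0` for which the eigenspaces of `|A|` for the
eigenvalues `μ ≥ t` span a space of dimension greater than `n` (and `0` if there is none). -/
def sNumbers (A : H →L[ℂ] H) (n : ℕ) : ℝ :=
  sSup {t : ℝ | 0 < t ∧ (n : Cardinal) <
    Module.rank ℂ (⨆ μ : ℝ, ⨆ _ : t ≤ μ,
      Module.End.eigenspace ((CFC.abs A : H →L[ℂ] H) : Module.End ℂ H) (μ : ℂ) : Submodule ℂ H)}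

/-- `K(H)⁺`, the positive compact operators. -/
def posCompact : Set (H →L[ℂ] H) := {B | IsCompactOperator B ∧ B.IsPositive}

/-- The trace of a positive operator, a number in `[0, ∞]`. -/
def tr (e : HilbertBasis ℕ ℂ H) (T : H →L[ℂ] H) : ℝ≥0∞ :=
  ∑' k : ℕ, ENNReal.ofReal (inner ℂ (e k) (T (e k))).re

/-- The trace class operators: those `T` with `tr |T| < ∞`. -/
def traceClass (e : HilbertBasis ℕ ℂ H) : Set (H →L[ℂ] H) := {T | tr e (CFC.abs T) < ∞}

/-- The operators that are diagonal with respect to the orthonormal basis `e`. -/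
def diagonalOps (e : HilbertBasis ℕ ℂ H) : Set (H →L[ℂ] H) :=
  {T | ∀ i j : ℕ, i ≠ j → inner ℂ (e i) (T (e j)) = 0}

theorem norm_diag_le (e : HilbertBasis ℕ ℂ H) (T : H →L[ℂ] H) (k : ℕ) :
    ‖(inner ℂ (e k) (T (e k)) : ℂ) • ContinuousLinearMap.id ℂ ℂ‖ ≤ ‖T‖ := by
  have h1 : ‖e k‖ = 1 := e.orthonormal.1 k
  have h2 := norm_inner_le_norm (𝕜 := ℂ) (e k) (T (e k))
  have h3 := T.le_opNorm (e k)
  rw [norm_smul, ContinuousLinearMap.norm_id, mul_one]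
  simp only [h1, one_mul, mul_one] at h2 h3
  exact h2.trans h3

/-- The conditional expectation onto the diagonal operators: `E(T)` has the same diagonal as `T`
in the basis `e`, and its off-diagonal entries vanish. It is built by transporting to `H`
the multiplication of `ℓ²` sequences by the bounded sequence `⟪e k, T (e k)⟫`. -/
def expect (e : HilbertBasis ℕ ℂ H) (T : H →L[ℂ] H) : H →L[ℂ] H :=
  (e.repr.symm.toContinuousLinearEquiv : lp (fun _ : ℕ => ℂ) 2 →L[ℂ] H) ∘L
    (lp.mapCLM 2
      (fun k : ℕ => (inner ℂ (e k) (T (e k)) : ℂ) • ContinuousLinearMap.id ℂ ℂ)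
      (norm_nonneg T) (norm_diag_le e T)) ∘L
    (e.repr.toContinuousLinearEquiv : H →L[ℂ] lp (fun _ : ℕ => ℂ) 2)

theorem inner_expect (e : HilbertBasis ℕ ℂ H) (T : H →L[ℂ] H) (i : ℕ) (x : H) :
    inner ℂ (e i) (expect e T x) = inner ℂ (e i) (T (e i)) * inner ℂ (e i) x := by
  rw [← e.repr_apply_apply, ← e.repr_apply_apply x]
  simp [expect]

theorem inner_expect_basis (e : HilbertBasis ℕ ℂ H) (T : H →L[ℂ] H) (i j : ℕ) :
    inner ℂ (e i) (expect e T (e j)) = if i = j then inner ℂ (e i) (T (e i)) else 0 := by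
  rw [inner_expect, orthonormal_iff_ite.mp e.orthonormal i j]
  simp

end Operators

end

end SchurHorn

namespace SchurHorn

open Filter Topology

/-! Let `a` be the eigenvalues of `A` and `V` a contraction. The diagonal of `V A V*` is obtained
from `a` by the matrix `‖⟪e k, V (b i)⟫‖ ^ 2`, whose row and column sums are at most one. This gives
Schur's half (`IsEigenbasis.sum_re_inner_conj_le`): majorization, with a defect term that measures
how far the vectors `V* u k` are from unit length. If `R_A = 1`, then `V` is an isometry and the
trace is preserved as well (`IsEigenbasis.tsum_re_inner_conj`). For finite trace this makes the
difference of partial sums tend to zero, which is strong majorization.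

Horn's half (`exists_hilbertBasis_diagonal`) realizes `ξ` by successive plane rotations. Each step
splits off a unit vector with the prescribed diagonal value and replaces two eigenvalues by one,
keeping their total after removal of that value (`HornState.exists_next`). The vectors split off are
orthonormal; the issue is completeness. After `n` steps an eigenvector `f j` lies in the span of the
vectors produced so far and the first `j + 1` remaining ones. Positivity of `A` bounds its
components along the latter by their diagonal values, which become small whenever the partial sums
of `a` and `ξ` come close.

Strong majorization supplies that closeness. If `ξ` is not summable, it is forced instead by
permuting `a` (`exists_rearrangement`): small late eigenvalues are moved forward until the slack is
used up. This is why no lower limit condition appears when the trace is infinite.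

For (i), a positive operator with a zero diagonal entry kills the corresponding basis vector, so
taking the expectation cannot enlarge the kernel. For (iii), in finite rank every admissible `V`
agrees on the range of `A` with a unitary. In infinite rank with a nontrivial kernel, the sequence
of positive eigenvalues is the diagonal of some `V A V*`. A unitary conjugate with the same diagonal
would give equality in Schur's inequality and force `R_A = 1`. -/

/-! ### Enumeration and rearrangement of null sequences -/

theorem exists_antitone_enum {ι : Type*} (a : ι → ℝ) (hinf : {i | 0 < a i}.Infinite)
    (hfin : ∀ t : ℝ, 0 < t → {i | t ≤ a i}.Finite) :
    ∃ σ : ℕ → ι, Function.Injective σ ∧ Antitone (a ∘ σ) ∧ (∀ k, 0 < a (σ k)) ∧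
      ∀ i, 0 < a i → i ∈ Set.range σ := by
  classical
  -- Greedy choice: outside a finite set a largest value exists, since only finitely many values
  -- exceed any positive one.
  have hpick : ∀ F : Finset ι, ∃ i, i ∉ F ∧ 0 < a i ∧ ∀ j, j ∉ F → a j ≤ a i := by
    intro F
    obtain ⟨i₀, hi₀, hi₀F⟩ := (hinf.sdiff F.finite_toSet).nonempty
    have hf : ({i | a i₀ ≤ a i} \ (F : Set ι)).Finite := (hfin _ hi₀).sdiff
    obtain ⟨i, hi, hmax⟩ := Set.exists_max_image _ a hf ⟨i₀, le_refl (a i₀), hi₀F⟩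
    refine ⟨i, hi.2, lt_of_lt_of_le hi₀ hi.1, fun j hj => ?_⟩
    by_cases h : a i₀ ≤ a j
    · exact hmax j ⟨h, hj⟩
    · exact (not_le.mp h).le.trans hi.1
  choose pick hp1 hp2 hp3 using hpick
  let F : ℕ → Finset ι := fun n => Nat.rec ∅ (fun _ G => insert (pick G) G) n
  have hF : ∀ n, F (n + 1) = insert (pick (F n)) (F n) := fun n => rfl
  have hmono : Monotone F := monotone_nat_of_le_succ fun n => by
    rw [hF]; exact Finset.subset_insert _ _
  have hmem : ∀ n, pick (F n) ∈ F (n + 1) := fun n => by rw [hF]; exact Finset.mem_insert_self _ _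
  have hinj : Function.Injective fun n => pick (F n) := by
    have hne : ∀ m n, m < n → pick (F m) ≠ pick (F n) := fun m n hmn h =>
      hp1 (F n) (h ▸ hmono (Nat.succ_le_of_lt hmn) (hmem m))
    intro m n h
    rcases lt_trichotomy m n with hlt | heq | hlt
    · exact absurd h (hne m n hlt)
    · exact heq
    · exact absurd h.symm (hne n m hlt)
  refine ⟨fun n => pick (F n), hinj, ?_, fun k => hp2 _, fun i hi => ?_⟩
  · exact antitone_nat_of_succ_le fun n =>
      hp3 _ _ fun h => hp1 (F (n + 1)) (hmono (Nat.le_succ n) h)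
  · by_contra hr
    have hnot : ∀ n, i ∉ F n := by
      intro n
      induction n with
      | zero => exact Finset.notMem_empty i
      | succ n ih =>
        rw [hF, Finset.mem_insert, not_or]
        exact ⟨fun h => hr ⟨n, h.symm⟩, ih⟩
    -- A missed index would be dominated by every index picked, contradicting finiteness of its
    -- upper level set.
    exact (Set.infinite_of_injective_forall_mem hinj
      (s := {j | a i ≤ a j}) fun n => hp3 _ _ (hnot n)) (hfin _ hi)

/-- The permutation of `ℕ` that moves the segment `[D, D + T)` in front of `[L, D)`. -/
def segmentShift (L D T : ℕ) (h : L ≤ D) : Equiv.Perm ℕ where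
  toFun j := if j < L then j else if j < L + T then j - L + D else if j < D + T then j - T else j
  invFun i := if i < L then i else if i < D then i + T else if i < D + T then i - D + L else i
  left_inv j := by dsimp only; split_ifs <;> omega
  right_inv j := by dsimp only; split_ifs <;> omega

theorem sum_le_sum_perm {a : ℕ → ℝ} (ha : ∀ j, 0 ≤ a j) (ρ : Equiv.Perm ℕ) {m n : ℕ}
    (h : ∀ j < m, ρ.symm j < n) :
    ∑ j ∈ Finset.range m, a j ≤ ∑ j ∈ Finset.range n, a (ρ j) := by
  have he : ∑ j ∈ Finset.range n, a (ρ j) = ∑ j ∈ (Finset.range n).map ρ.toEmbedding, a j := by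
    simp
  rw [he]
  refine Finset.sum_le_sum_of_subset_of_nonneg (fun j hj => ?_) fun j _ _ => ha j
  rw [Finset.mem_map]
  exact ⟨ρ.symm j, Finset.mem_range.mpr (h j (Finset.mem_range.mp hj)), by simp⟩

/-- At a place `L` where the slack is nearly minimal, `T` tiny terms of `a` are inserted, delaying
the terms after `L` by `T` places. Meanwhile `ξ` keeps accumulating and consumes the slack.
Near-minimality of the slack at `L` ensures that the delay never breaks majorization later. -/
theorem exists_block_rearrangement {a ξ : ℕ → ℝ} (ha0 : ∀ j, 0 ≤ a j)
    (ha : Tendsto a atTop (𝓝 0)) (hξ : Antitone ξ) (hξ0 : ∀ j, 0 ≤ ξ j)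
    (hξlim : Tendsto ξ atTop (𝓝 0)) (hns : ¬ Summable ξ) (hmaj : Majorizes ξ a)
    (N : ℕ) {ε : ℝ} (hε : 0 < ε) :
    ∃ K, N < K ∧ ∃ ρ : Equiv.Perm ℕ, (∀ j, j < N ∨ K ≤ j → ρ j = j) ∧
      Majorizes ξ (a ∘ ρ) ∧ ∃ n, N ≤ n ∧ n ≤ K ∧ ∑ j ∈ Finset.range n, (a (ρ j) - ξ j) < ε := by
  set S : ℕ → ℝ := fun n => ∑ j ∈ Finset.range n, (a j - ξ j) with hS
  have hSeq : ∀ n, S n = ∑ j ∈ Finset.range n, a j - ∑ j ∈ Finset.range n, ξ j := fun n => by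
    simp only [hS, Finset.sum_sub_distrib]
  have hS0 : ∀ n, 0 ≤ S n := fun n => by rw [hSeq]; linarith [hmaj n]
  obtain ⟨N', hN', hξN'⟩ : ∃ N', N ≤ N' ∧ ∀ j, N' ≤ j → ξ j < ε / 4 := by
    obtain ⟨M, hM⟩ := eventually_atTop.mp (hξlim.eventually (gt_mem_nhds (show 0 < ε / 4 by linarith)))
    exact ⟨max N M, le_max_left _ _, fun j hj => hM j ((le_max_right _ _).trans hj)⟩
  obtain ⟨L, hL, hLmin⟩ : ∃ L, N' ≤ L ∧ ∀ n, N' ≤ n → S L < S n + ε / 4 := by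
    have hne : (S '' Set.Ici N').Nonempty := ⟨_, N', Set.self_mem_Ici, rfl⟩
    obtain ⟨_, ⟨L, hL, rfl⟩, hlt⟩ := Real.lt_sInf_add_pos hne (show 0 < ε / 4 by linarith)
    refine ⟨L, hL, fun n hn => hlt.trans_le ?_⟩
    have := csInf_le (⟨0, by rintro _ ⟨n, -, rfl⟩; exact hS0 n⟩ : BddBelow (S '' Set.Ici N'))
      ⟨n, hn, rfl⟩
    linarith
  -- A lower bound for the slack from `N'` on, and within `ε / 4` of its value at `L`; it is the
  -- amount that the delay may consume.
  set i : ℝ := max (S L - ε / 4) 0 with hi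
  have hiS : ∀ n, N' ≤ n → i ≤ S n := fun n hn => max_le (by linarith [hLmin n hn]) (hS0 n)
  have hSi : S L ≤ i + ε / 4 := by linarith [le_max_left (S L - ε / 4) 0]
  have hex : ∃ T, i < ∑ k ∈ Finset.range (T + 1), ξ (L + k) := by
    by_contra hcon
    push Not at hcon
    apply hns
    rw [← summable_nat_add_iff L]
    refine summable_of_sum_range_le (c := i) (fun n => hξ0 _) fun n => ?_
    simp only [add_comm _ L]
    refine le_trans ?_ (hcon n)
    rw [Finset.sum_range_succ]
    linarith [hξ0 (L + n)]
  classical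
  -- The longest delay whose cost at `L` stays within `i`; it exists because `ξ` is not summable. As
  -- `ξ` is nonincreasing, the same delay costs no more at later places.
  obtain ⟨T, hT1, hT2⟩ : ∃ T, i < ∑ k ∈ Finset.range (T + 1), ξ (L + k) ∧
      ∑ k ∈ Finset.range T, ξ (L + k) ≤ i := by
    refine ⟨Nat.find hex, Nat.find_spec hex, ?_⟩
    rcases h : Nat.find hex with _ | T
    · simp [hi]
    · exact not_lt.mp (Nat.find_min hex (m := T) (by omega))
  obtain ⟨D, hD, haD⟩ : ∃ D, L ≤ D ∧ ∀ j, D ≤ j → a j < ε / 4 / (T + 1) := by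
    obtain ⟨M, hM⟩ := eventually_atTop.mp (ha.eventually
      (gt_mem_nhds (show 0 < ε / 4 / ((T : ℝ) + 1) by positivity)))
    exact ⟨max L M, le_max_left _ _, fun j hj => hM j ((le_max_right _ _).trans hj)⟩
  have hξsum : ∀ m, L ≤ m → ∑ k ∈ Finset.range T, ξ (m + k) ≤ i := fun m hm =>
    (Finset.sum_le_sum fun k _ => hξ (by omega)).trans hT2
  -- The extra `1` makes `N < K` strict even when `D = N` and `T = 0`. The slack becomes small at
  -- the end of the inserted segment, `L + T`.
  refine ⟨D + T + 1, by omega, segmentShift L D T hD, ?_, ?_, L + T, by omega, by omega, ?_⟩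
  · intro j hj
    simp only [segmentShift, Equiv.coe_fn_mk]
    split_ifs
    all_goals omega
  · intro n
    have key : ∀ m, (∀ j < m, (segmentShift L D T hD).symm j < n) →
        ∑ j ∈ Finset.range n, ξ j ≤ ∑ j ∈ Finset.range m, a j →
        ∑ j ∈ Finset.range n, ξ j ≤ ∑ j ∈ Finset.range n, (a ∘ segmentShift L D T hD) j :=
      fun m h1 h2 => h2.trans (sum_le_sum_perm ha0 _ h1)
    rcases le_total n L with h | h
    · refine key n (fun j hj => ?_) (hmaj n)
      simp only [segmentShift, Equiv.coe_fn_symm_mk]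
      split_ifs <;> omega
    rcases le_total n (L + T) with h' | h'
    · refine key L (fun j hj => ?_) ?_
      · simp only [segmentShift, Equiv.coe_fn_symm_mk]
        split_ifs <;> omega
      · have h1 : ∑ j ∈ Finset.range n, ξ j ≤ ∑ j ∈ Finset.range (L + T), ξ j :=
          Finset.sum_le_sum_of_subset_of_nonneg (Finset.range_mono h') fun j _ _ => hξ0 j
        rw [Finset.sum_range_add] at h1
        linarith [hiS L hL, hSeq L]
    rcases le_total n (D + T) with h'' | h''
    · obtain ⟨m, rfl⟩ : ∃ m, n = m + T := ⟨n - T, by omega⟩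
      refine key m (fun j hj => ?_) ?_
      · simp only [segmentShift, Equiv.coe_fn_symm_mk]
        split_ifs <;> omega
      · rw [Finset.sum_range_add]
        linarith [hiS m (by omega), hSeq m, hξsum m (by omega)]
    · refine key n (fun j hj => ?_) (hmaj n)
      simp only [segmentShift, Equiv.coe_fn_symm_mk]
      split_ifs <;> omega
  · rw [Finset.sum_sub_distrib, Finset.sum_range_add ξ,
      Finset.sum_range_add (fun j => a (segmentShift L D T hD j))]
    have h1 : ∑ j ∈ Finset.range L, a (segmentShift L D T hD j) = ∑ j ∈ Finset.range L, a j := by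
      refine Finset.sum_congr rfl fun j hj => ?_
      have := Finset.mem_range.mp hj
      simp [segmentShift, this]
    have h2 : ∑ k ∈ Finset.range T, a (segmentShift L D T hD (L + k)) ≤
        ∑ k ∈ Finset.range T, ε / 4 / (T + 1) := by
      refine Finset.sum_le_sum fun k hk => (haD _ ?_).le
      have := Finset.mem_range.mp hk
      simp only [segmentShift, Equiv.coe_fn_mk]
      split_ifs <;> omega
    have h3 : ∑ k ∈ Finset.range T, ε / 4 / ((T : ℝ) + 1) ≤ ε / 4 := by
      rw [Finset.sum_const, Finset.card_range, nsmul_eq_mul, mul_div_assoc', div_le_iff₀ (by positivity)]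
      nlinarith
    rw [Finset.sum_range_succ] at hT1
    linarith [hSeq L, hξN' (L + T) (by omega)]

theorem exists_perm_of_blocks (N : ℕ → ℕ) (hN0 : N 0 = 0) (hN : StrictMono N)
    (ρ : ℕ → Equiv.Perm ℕ) (hρ : ∀ i j, j < N i ∨ N (i + 1) ≤ j → ρ i j = j) :
    ∃ π : Equiv.Perm ℕ, ∀ i j, N i ≤ j → j < N (i + 1) → π j = ρ i j := by
  have hex : ∀ n, ∃ i, N i ≤ n ∧ n < N (i + 1) := by
    intro n
    classical
    have h : ∃ i, n < N (i + 1) := ⟨n, lt_of_lt_of_le n.lt_succ_self (hN.id_le _)⟩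
    refine ⟨Nat.find h, ?_, Nat.find_spec h⟩
    rcases hi : Nat.find h with _ | i
    · rw [hN0]; exact Nat.zero_le _
    · exact not_lt.mp (Nat.find_min h (m := i) (by omega))
  choose idx h1 h2 using hex
  have huniq : ∀ i n, N i ≤ n → n < N (i + 1) → idx n = i := by
    intro i n h3 h4
    have h5 := hN.lt_iff_lt.mp ((h1 n).trans_lt h4)
    have h6 := hN.lt_iff_lt.mp (h3.trans_lt (h2 n))
    omega
  have hblock : ∀ i n, N i ≤ n → n < N (i + 1) → N i ≤ ρ i n ∧ ρ i n < N (i + 1) := by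
    intro i n h3 h4
    by_contra hcon
    have h5 : ρ i n < N i ∨ N (i + 1) ≤ ρ i n := by omega
    have h6 := (ρ i).injective (hρ i _ h5)
    omega
  have hblock' : ∀ i n, N i ≤ n → n < N (i + 1) →
      N i ≤ (ρ i).symm n ∧ (ρ i).symm n < N (i + 1) := by
    intro i n h3 h4
    by_contra hcon
    have h5 : (ρ i).symm n < N i ∨ N (i + 1) ≤ (ρ i).symm n := by omega
    have h6 := hρ i _ h5
    rw [Equiv.apply_symm_apply] at h6
    omega
  refine ⟨⟨fun n => ρ (idx n) n, fun n => (ρ (idx n)).symm n, fun n => ?_, fun n => ?_⟩, ?_⟩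
  · have h := hblock (idx n) n (h1 n) (h2 n)
    simp only [huniq _ _ h.1 h.2, Equiv.symm_apply_apply]
  · have h := hblock' (idx n) n (h1 n) (h2 n)
    simp only [huniq _ _ h.1 h.2, Equiv.apply_symm_apply]
  · intro i j h3 h4
    simp only [Equiv.coe_fn_mk, huniq i j h3 h4]

/-- Block rearrangements with tolerances `1 / (k + 1)` are glued over consecutive blocks. Each one
preserves the total of `a` up to either end of its block, so the stages do not interact: inside a
block the partial sums are those of that block's permutation alone. -/
theorem exists_rearrangement {a ξ : ℕ → ℝ} (ha0 : ∀ j, 0 ≤ a j)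
    (ha : Tendsto a atTop (𝓝 0)) (hξ : Antitone ξ) (hξ0 : ∀ j, 0 ≤ ξ j)
    (hξlim : Tendsto ξ atTop (𝓝 0)) (hns : ¬ Summable ξ) (hmaj : Majorizes ξ a) :
    ∃ π : Equiv.Perm ℕ, Majorizes ξ (a ∘ π) ∧
      ∀ ε : ℝ, 0 < ε → ∀ M, ∃ n, M ≤ n ∧ ∑ j ∈ Finset.range n, (a (π j) - ξ j) < ε := by
  have hstage := fun (N : ℕ) (k : ℕ) => exists_block_rearrangement ha0 ha hξ hξ0 hξlim hns hmaj N
    (ε := 1 / ((k : ℝ) + 1)) (by positivity)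
  choose K hK ρ hρ hρmaj n hn1 hn2 hn3 using hstage
  let N : ℕ → ℕ := fun i => Nat.rec 0 (fun k M => K M k) i
  have hNs : ∀ i, N (i + 1) = K (N i) i := fun i => rfl
  have hNmono : StrictMono N := strictMono_nat_of_lt_succ fun i => by rw [hNs]; exact hK _ _
  obtain ⟨π, hπ⟩ := exists_perm_of_blocks N rfl hNmono (fun i => ρ (N i) i)
    (fun i j h => hρ _ _ j (by rwa [hNs] at h))
  have hlow : ∀ i, ∀ n ≤ N i, ∑ j ∈ Finset.range n, a (ρ (N i) i j) = ∑ j ∈ Finset.range n, a j :=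
    fun i n hn => Finset.sum_congr rfl fun j hj => by
      rw [hρ _ _ j (Or.inl ((Finset.mem_range.mp hj).trans_le hn))]
  have hend : ∀ i, ∑ j ∈ Finset.range (N (i + 1)), a (ρ (N i) i j) =
      ∑ j ∈ Finset.range (N (i + 1)), a j := by
    intro i
    refine Equiv.Perm.sum_comp (ρ (N i) i) (Finset.range (N (i + 1))) a fun j hj => ?_
    simp only [Finset.coe_range, Set.mem_Iio]
    by_contra hcon
    exact hj (hρ _ _ j (Or.inr (by rw [← hNs]; omega)))
  have hpre : ∀ i, (∑ j ∈ Finset.range (N i), a (π j) = ∑ j ∈ Finset.range (N i), a j) ∧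
      ∀ n, N i ≤ n → n ≤ N (i + 1) →
        ∑ j ∈ Finset.range n, a (π j) = ∑ j ∈ Finset.range n, a (ρ (N i) i j) := by
    intro i
    have hstep : ∀ i, (∑ j ∈ Finset.range (N i), a (π j) = ∑ j ∈ Finset.range (N i), a j) →
        ∀ n, N i ≤ n → n ≤ N (i + 1) →
        ∑ j ∈ Finset.range n, a (π j) = ∑ j ∈ Finset.range n, a (ρ (N i) i j) := by
      intro i hi n h1 h2
      rw [← Finset.sum_range_add_sum_Ico _ h1, ← Finset.sum_range_add_sum_Ico _ h1, hi,
        hlow i _ le_rfl]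
      congr 1
      refine Finset.sum_congr rfl fun j hj => ?_
      rw [Finset.mem_Ico] at hj
      rw [hπ i j hj.1 (hj.2.trans_le h2)]
    have h0 : ∀ i, ∑ j ∈ Finset.range (N i), a (π j) = ∑ j ∈ Finset.range (N i), a j := by
      intro i
      induction i with
      | zero => simp [N]
      | succ i ih => rw [hstep i ih _ (hNmono i.lt_succ_self).le le_rfl, hend]
    exact ⟨h0 i, hstep i (h0 i)⟩
  refine ⟨π, fun n => ?_, fun ε hε M => ?_⟩
  · obtain ⟨i, h1, h2⟩ : ∃ i, N i ≤ n ∧ n ≤ N (i + 1) := by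
      classical
      have h : ∃ i, n ≤ N (i + 1) := ⟨n, n.le_succ.trans (hNmono.id_le _)⟩
      refine ⟨Nat.find h, ?_, Nat.find_spec h⟩
      rcases hi : Nat.find h with _ | i
      · exact Nat.zero_le _
      · exact (not_le.mp (Nat.find_min h (m := i) (by omega))).le
    have := hρmaj (N i) i n
    simp only [Function.comp_apply] at this ⊢
    rwa [(hpre i).2 n h1 h2]
  · obtain ⟨k, hk⟩ := exists_nat_one_div_lt hε
    set i := max k M
    refine ⟨n (N i) i, (le_max_right k M).trans ((hNmono.id_le i).trans (hn1 _ _)), ?_⟩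
    have h1 := hn3 (N i) i
    rw [Finset.sum_sub_distrib] at h1 ⊢
    rw [(hpre i).2 _ (hn1 _ _) (hn2 _ _)]
    refine h1.trans (lt_of_le_of_lt ?_ hk)
    have : (k : ℝ) ≤ (i : ℝ) := by exact_mod_cast le_max_left k M
    exact one_div_le_one_div_of_le (by positivity) (by linarith)

/-- The sequence `u` with its entries at `m` and `m + 1` replaced by the single entry `y`. -/
def mergeAt {α : Type*} (m : ℕ) (y : α) (u : ℕ → α) (j : ℕ) : α :=
  if j < m then u j else if j = m then y else u (j + 1)

theorem sum_mergeAt_of_le {m M : ℕ} (h : M ≤ m) (y : ℝ) (u : ℕ → ℝ) :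
    ∑ j ∈ Finset.range M, mergeAt m y u j = ∑ j ∈ Finset.range M, u j :=
  Finset.sum_congr rfl fun j hj => by
    simp [mergeAt, (Finset.mem_range.mp hj).trans_le h]

theorem sum_mergeAt_of_lt {m M : ℕ} (h : m < M) (y : ℝ) (u : ℕ → ℝ) :
    ∑ j ∈ Finset.range M, mergeAt m y u j =
      ∑ j ∈ Finset.range (M + 1), u j - u m - u (m + 1) + y := by
  induction M, h using Nat.le_induction with
  | base =>
    rw [Finset.sum_range_succ, sum_mergeAt_of_le le_rfl, Finset.sum_range_succ,
      Finset.sum_range_succ]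
    simp only [mergeAt, lt_irrefl, if_true, if_false]
    ring
  | succ M hM ih =>
    rw [Finset.sum_range_succ, ih, Finset.sum_range_succ _ (M + 1)]
    have h1 : ¬ M < m := by omega
    have h2 : ¬ M = m := by omega
    simp only [mergeAt, h1, h2, if_false]
    ring

theorem tendsto_mergeAt {m : ℕ} {y : ℝ} {u : ℕ → ℝ} {l : ℝ} (hu : Tendsto u atTop (𝓝 l)) :
    Tendsto (mergeAt m y u) atTop (𝓝 l) := by
  refine ((tendsto_add_atTop_iff_nat 1).mpr hu).congr' ?_
  filter_upwards [eventually_gt_atTop m] with j hj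
  have h1 : ¬ j < m := by omega
  have h2 : ¬ j = m := by omega
  simp [mergeAt, h1, h2]

/-! ### One step of the Horn recursion -/

section Merge

variable {H : Type*} [NormedAddCommGroup H] [InnerProductSpace ℂ H]

theorem inner_merge_self {h : ℕ → H} {T : H →L[ℂ] H} {t : ℕ → ℝ}
    (hT : ∀ i j, inner ℂ (h i) (T (h j)) = if i = j then (t i : ℂ) else 0) (c s : ℝ) (m : ℕ) :
    inner ℂ ((c : ℂ) • h m + (s : ℂ) • h (m + 1)) (T ((c : ℂ) • h m + (s : ℂ) • h (m + 1))) =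
      ((c ^ 2 * t m + s ^ 2 * t (m + 1) : ℝ) : ℂ) := by
  simp only [map_add, map_smul, inner_add_left, inner_add_right, inner_smul_left,
    inner_smul_right, hT, Complex.conj_ofReal]
  simp
  ring

theorem inner_mergeAt {h : ℕ → H} {T : H →L[ℂ] H} {t : ℕ → ℝ}
    (hT : ∀ i j, inner ℂ (h i) (T (h j)) = if i = j then (t i : ℂ) else 0) (c s : ℝ) (m : ℕ)
    (i j : ℕ) :
    inner ℂ (mergeAt m ((-s : ℂ) • h m + (c : ℂ) • h (m + 1)) h i)
      (T (mergeAt m ((-s : ℂ) • h m + (c : ℂ) • h (m + 1)) h j)) =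
      if i = j then ((mergeAt m (s ^ 2 * t m + c ^ 2 * t (m + 1)) t i : ℝ) : ℂ) else 0 := by
  have hi : ∀ i, i < m ∨ i = m ∨ m < i := fun i => by omega
  rcases hi i with h1 | rfl | h1 <;> rcases hi j with h2 | rfl | h2
  all_goals
    simp only [mergeAt, not_lt_of_gt, lt_irrefl, if_true, if_false, *, ne_of_gt, ne_of_lt,
      map_add, map_smul, inner_add_left, inner_add_right, inner_smul_left,
      inner_smul_right, Complex.conj_ofReal, map_neg]
    try split_ifs
    all_goals first
      | omega
      | simp
  all_goals ring

theorem inner_merge_mergeAt {h : ℕ → H} (hh : Orthonormal ℂ h) (c s : ℝ) (m j : ℕ) :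
    inner ℂ ((c : ℂ) • h m + (s : ℂ) • h (m + 1))
      (mergeAt m ((-s : ℂ) • h m + (c : ℂ) • h (m + 1)) h j) = 0 := by
  have hT := orthonormal_iff_ite.mp hh
  have hi : j < m ∨ j = m ∨ m < j := by omega
  rcases hi with h2 | rfl | h2
  all_goals
    simp only [mergeAt, not_lt_of_gt, lt_irrefl, if_true, if_false, *, ne_of_gt, ne_of_lt,
      inner_add_left, inner_add_right, inner_smul_left,
      inner_smul_right, Complex.conj_ofReal]
    try split_ifs
    all_goals first
      | omega
      | simp
  all_goals ring

/-- The inverse rotation recovers `h m` and `h (m + 1)`, and vectors beyond them have moved down one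
index. Hence indices up to `j` suffice, however often the step is iterated. -/
theorem mem_of_merge_mem {h : ℕ → H} {c s : ℝ} (hcs : c ^ 2 + s ^ 2 = 1) (m j : ℕ)
    (V : Submodule ℂ H) (hg : (c : ℂ) • h m + (s : ℂ) • h (m + 1) ∈ V)
    (hV : ∀ p ≤ j, mergeAt m ((-s : ℂ) • h m + (c : ℂ) • h (m + 1)) h p ∈ V) : h j ∈ V := by
  have hcs' : (c : ℂ) ^ 2 + (s : ℂ) ^ 2 = 1 := by exact_mod_cast hcs
  have hy : m ≤ j → (-s : ℂ) • h m + (c : ℂ) • h (m + 1) ∈ V := fun hmj => by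
    simpa [mergeAt] using hV m hmj
  rcases lt_trichotomy j m with h1 | rfl | h1
  · simpa [mergeAt, h1] using hV j le_rfl
  · have h2 := V.sub_mem (V.smul_mem (c : ℂ) hg) (V.smul_mem (s : ℂ) (hy le_rfl))
    convert h2 using 1
    calc h j = ((c : ℂ) ^ 2 + (s : ℂ) ^ 2) • h j := by rw [hcs', one_smul]
      _ = _ := by module
  · rcases Nat.eq_or_lt_of_le h1 with rfl | h3
    · have h2 := V.add_mem (V.smul_mem (s : ℂ) hg) (V.smul_mem (c : ℂ) (hy (by omega)))
      convert h2 using 1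
      calc h (m + 1) = ((c : ℂ) ^ 2 + (s : ℂ) ^ 2) • h (m + 1) := by rw [hcs', one_smul]
        _ = _ := by module
    · obtain ⟨k, rfl⟩ : ∃ k, j = k + 1 := ⟨j - 1, by omega⟩
      have h4 := hV k (by omega)
      have h5 : ¬ k < m := by omega
      have h6 : ¬ k = m := by omega
      simpa [mergeAt, h5, h6] using h4

/-- The invariant of the Horn recursion: the orthonormal vectors `h` diagonalize the compression
of `T` to their span, with eigenvalues `a`, and the partial sums of `a` dominate those of `x`. -/
structure HornState (T : H →L[ℂ] H) (x a : ℕ → ℝ) (h : ℕ → H) : Prop where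
  orthonormal : Orthonormal ℂ h
  inner_apply : ∀ i j, inner ℂ (h i) (T (h j)) = if i = j then (a i : ℂ) else 0
  nonneg : ∀ j, 0 ≤ a j
  tendsto : Tendsto a atTop (𝓝 0)
  majorizes : Majorizes x a

theorem HornState.exists_next {T : H →L[ℂ] H} {x a : ℕ → ℝ} {h : ℕ → H} (hs : HornState T x a h)
    (hx : Antitone x) (hx0 : 0 < x 0) :
    ∃ (a' : ℕ → ℝ) (h' : ℕ → H) (g : H), HornState T (fun j => x (j + 1)) a' h' ∧
      ‖g‖ = 1 ∧ inner ℂ g (T g) = (x 0 : ℂ) ∧ (∀ j, inner ℂ g (h' j) = 0) ∧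
      (∀ v, (∀ j, inner ℂ v (h j) = 0) → inner ℂ v g = 0 ∧ ∀ j, inner ℂ v (h' j) = 0) ∧
      (∀ (V : Submodule ℂ H) (j : ℕ), g ∈ V → (∀ p ≤ j, h' p ∈ V) → h j ∈ V) ∧
      ∀ M, ∑ j ∈ Finset.range M, a' j + x 0 ≤ ∑ j ∈ Finset.range (M + 1), a j := by
  classical
  have hex : ∃ m, a (m + 1) ≤ x 0 := by
    have h1 := ((tendsto_add_atTop_iff_nat 1).mpr hs.tendsto).eventually (gt_mem_nhds hx0)
    obtain ⟨m, hm⟩ := h1.exists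
    exact ⟨m, hm.le⟩
  -- The eigenvalues need not be monotone; the first crossing of `x 0` suffices, because all entries
  -- up to `m` are then at least `x 0`.
  set m := Nat.find hex with hm
  have hm1 : a (m + 1) ≤ x 0 := Nat.find_spec hex
  have hm2 : ∀ j ≤ m, x 0 ≤ a j := by
    intro j hj
    rcases j with _ | j
    · simpa using hs.majorizes 1
    · exact (not_le.mp (Nat.find_min hex (m := j) (by omega))).le
  obtain ⟨u, v, hu, hv, huv, hx0'⟩ : ∃ u v : ℝ, 0 ≤ u ∧ 0 ≤ v ∧ u + v = 1 ∧
      u * a m + v * a (m + 1) = x 0 := by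
    have h1 : x 0 ∈ segment ℝ (a m) (a (m + 1)) := by
      rw [segment_symm, segment_eq_Icc (hm1.trans (hm2 m le_rfl))]
      exact ⟨hm1, hm2 m le_rfl⟩
    obtain ⟨u, v, hu, hv, huv, h2⟩ := h1
    exact ⟨u, v, hu, hv, huv, h2⟩
  -- Cosine and sine of the rotation: their squares are the weights writing `x 0` as a convex
  -- combination of `a m` and `a (m + 1)`.
  set c := √u
  set s := √v
  have hc : c ^ 2 = u := Real.sq_sqrt hu
  have hs' : s ^ 2 = v := Real.sq_sqrt hv
  have hcs : c ^ 2 + s ^ 2 = 1 := by rw [hc, hs', huv]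
  have hval : c ^ 2 * a m + s ^ 2 * a (m + 1) = x 0 := by rw [hc, hs', hx0']
  have hval' : s ^ 2 * a m + c ^ 2 * a (m + 1) = a m + a (m + 1) - x 0 := by
    rw [← hval]; linear_combination (a m + a (m + 1)) * hcs
  -- With the identity in place of `T`, the rotation computation also yields orthonormality and the
  -- unit norm.
  have hone : ∀ i j, inner ℂ (h i) ((ContinuousLinearMap.id ℂ H) (h j)) =
      if i = j then (((fun _ : ℕ => (1 : ℝ)) i : ℝ) : ℂ) else 0 := fun i j => by
    simpa using orthonormal_iff_ite.mp hs.orthonormal i j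
  have hsum : ∀ M, ∑ j ∈ Finset.range M, mergeAt m (a m + a (m + 1) - x 0) a j + x 0 ≤
      ∑ j ∈ Finset.range (M + 1), a j := by
    intro M
    rcases le_or_gt M m with hM | hM
    · rw [sum_mergeAt_of_le hM, Finset.sum_range_succ]
      linarith [hm2 M hM]
    · rw [sum_mergeAt_of_lt hM]
      linarith
  refine ⟨mergeAt m (a m + a (m + 1) - x 0) a,
    mergeAt m ((-s : ℂ) • h m + (c : ℂ) • h (m + 1)) h, (c : ℂ) • h m + (s : ℂ) • h (m + 1),
    ⟨?_, ?_, ?_, tendsto_mergeAt hs.tendsto, ?_⟩, ?_, ?_, inner_merge_mergeAt hs.orthonormal c s m,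
    ?_, fun V j => mem_of_merge_mem hcs m j V, hsum⟩
  · rw [orthonormal_iff_ite]
    intro i j
    have h1 := inner_mergeAt hone c s m i j
    simp only [ContinuousLinearMap.id_apply] at h1
    rw [h1]
    have h2 : mergeAt m (s ^ 2 * (1 : ℝ) + c ^ 2 * 1) (fun _ => (1 : ℝ)) i = 1 := by
      unfold mergeAt
      split_ifs
      · rfl
      · linarith
      · rfl
    rw [h2, Complex.ofReal_one]
  · intro i j
    rw [inner_mergeAt hs.inner_apply c s m i j, hval']
  · intro j
    unfold mergeAt
    split_ifs
    · exact hs.nonneg _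
    · linarith [hm2 m le_rfl, hs.nonneg (m + 1)]
    · exact hs.nonneg _
  · intro M
    rcases le_or_gt M m with hM | hM
    · rw [sum_mergeAt_of_le hM]
      refine Finset.sum_le_sum fun j hj => ?_
      exact (hx (Nat.zero_le _)).trans (hm2 j ((Finset.mem_range.mp hj).le.trans hM))
    · rw [sum_mergeAt_of_lt hM]
      have h1 := hs.majorizes (M + 1)
      rw [Finset.sum_range_succ'] at h1
      linarith
  · have h1 := inner_merge_self hone c s m
    simp only [ContinuousLinearMap.id_apply, mul_one, hcs] at h1
    rw [inner_self_eq_norm_sq_to_K] at h1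
    rw [← sq_eq_sq₀ (norm_nonneg _) zero_le_one, one_pow]
    exact Complex.ofReal_injective (by
      rw [Complex.ofReal_pow]
      exact h1)
  · rw [inner_merge_self hs.inner_apply, hval]
  · intro v hv
    refine ⟨by simp only [inner_add_right, inner_smul_right, hv, mul_zero, add_zero], fun j => ?_⟩
    unfold mergeAt
    split_ifs <;> simp only [inner_add_right, inner_smul_right, hv, mul_zero, add_zero]

end Merge

/-! ### Horn's theorem: completeness of the limiting system -/

section Operators

variable {H : Type*} [NormedAddCommGroup H] [InnerProductSpace ℂ H] [CompleteSpace H]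

/-- Split `v` into its component along `f` and a remainder orthogonal to `f`. The cross terms vanish
because `f` is an eigenvector, and the remainder contributes a nonnegative amount. -/
theorem eigenvalue_mul_norm_inner_sq_le {A : H →L[ℂ] H} (hA : A.IsPositive) {f : H} {t : ℝ}
    (hf : ‖f‖ = 1) (hAf : A f = (t : ℂ) • f) (v : H) :
    t * ‖(inner ℂ f v : ℂ)‖ ^ 2 ≤ (inner ℂ v (A v)).re := by
  set c : ℂ := inner ℂ f v with hc
  set r := v - c • f with hr
  have hff : (inner ℂ f f : ℂ) = 1 := by simp [inner_self_eq_norm_sq_to_K, hf]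
  have h1 : (inner ℂ f r : ℂ) = 0 := by
    rw [hr, inner_sub_right, inner_smul_right, hff, ← hc, mul_one, sub_self]
  have h2 : (inner ℂ r f : ℂ) = 0 := inner_eq_zero_symm.mp h1
  have h3 : (inner ℂ f (A r) : ℂ) = 0 := by
    have h := hA.isSymmetric f r
    simp only [ContinuousLinearMap.coe_coe] at h
    rw [← h, hAf, inner_smul_left, h1, mul_zero]
  have hv : v = c • f + r := by simp [hr]
  have h4 : (inner ℂ v (A v) : ℂ) = (t * ‖c‖ ^ 2 : ℝ) + inner ℂ r (A r) := by
    rw [hv]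
    simp only [map_add, map_smul, hAf, inner_add_left, inner_add_right, inner_smul_left,
      inner_smul_right, hff, h2, h3, mul_zero, add_zero, zero_add, mul_one]
    push_cast
    linear_combination (t : ℂ) * Complex.conj_mul' c
  have h5 : 0 ≤ (inner ℂ r (A r) : ℂ).re := by
    have := hA.2 r
    rw [ContinuousLinearMap.reApplyInnerSelf_apply] at this
    rwa [← inner_conj_symm, Complex.conj_re]
  rw [h4, Complex.add_re, Complex.ofReal_re]
  linarith

/-- Horn's theorem for compact operators: if the partial sums of the eigenvalues `a` dominate those
of `ξ`, and come arbitrarily close to them, then `ξ` is the diagonal of the operator in some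
orthonormal basis. -/
theorem exists_hilbertBasis_diagonal {A : H →L[ℂ] H} (hA : A.IsPositive) {f : ℕ → H}
    (hf : Orthonormal ℂ f) (hfsp : ⊤ ≤ (Submodule.span ℂ (Set.range f)).topologicalClosure)
    {a ξ : ℕ → ℝ} (hAf : ∀ j, A (f j) = (a j : ℂ) • f j) (ha0 : ∀ j, 0 < a j)
    (ha : Tendsto a atTop (𝓝 0)) (hξ : Antitone ξ) (hξ0 : ∀ j, 0 < ξ j)
    (hξlim : Tendsto ξ atTop (𝓝 0)) (hmaj : Majorizes ξ a)
    (hclose : ∀ ε : ℝ, 0 < ε → ∀ M, ∃ n, M ≤ n ∧ ∑ j ∈ Finset.range n, (a j - ξ j) < ε) :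
    ∃ g : HilbertBasis ℕ ℂ H, ∀ k, inner ℂ (g k) (A (g k)) = (ξ k : ℂ) := by
  have h0 : HornState A (fun j => ξ (j + 0)) a f :=
    ⟨hf, fun i j => by
      rw [hAf, inner_smul_right, orthonormal_iff_ite.mp hf i j]
      split_ifs with h
      · rw [h, mul_one]
      · simp, fun j => (ha0 j).le, ha, hmaj⟩
  have hnext : ∀ n (s : {s : (ℕ → ℝ) × (ℕ → H) // HornState A (fun j => ξ (j + n)) s.1 s.2}),
      ∃ (s' : {s : (ℕ → ℝ) × (ℕ → H) // HornState A (fun j => ξ (j + (n + 1))) s.1 s.2}) (g : H),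
      ‖g‖ = 1 ∧ inner ℂ g (A g) = (ξ n : ℂ) ∧ (∀ j, inner ℂ g (s'.1.2 j) = 0) ∧
      (∀ v, (∀ j, inner ℂ v (s.1.2 j) = 0) → inner ℂ v g = 0 ∧ ∀ j, inner ℂ v (s'.1.2 j) = 0) ∧
      (∀ (V : Submodule ℂ H) (j : ℕ), g ∈ V → (∀ p ≤ j, s'.1.2 p ∈ V) → s.1.2 j ∈ V) ∧
      ∀ M, ∑ j ∈ Finset.range M, s'.1.1 j + ξ n ≤ ∑ j ∈ Finset.range (M + 1), s.1.1 j := by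
    rintro n ⟨⟨a, h⟩, hs⟩
    obtain ⟨a', h', g, hs', h1⟩ := hs.exists_next (fun i j hij => hξ (by omega)) (hξ0 _)
    simp only [zero_add] at h1
    exact ⟨⟨(a', h'), by simpa only [add_assoc, add_comm 1 n] using hs'⟩, g, h1⟩
  choose nxt gs hg1 hgA hgh hperp hspan hsum using hnext
  let st : (n : ℕ) → {s : (ℕ → ℝ) × (ℕ → H) // HornState A (fun j => ξ (j + n)) s.1 s.2} :=
    fun n => Nat.rec ⟨(a, f), h0⟩ (fun n s => nxt n s) n
  have hst : ∀ n, st (n + 1) = nxt n (st n) := fun n => rfl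
  set α : ℕ → ℕ → ℝ := fun n => (st n).1.1 with hα
  set η : ℕ → ℕ → H := fun n => (st n).1.2 with hη
  set g : ℕ → H := fun n => gs n (st n) with hg
  have hη' : ∀ n, (nxt n (st n)).1.2 = η (n + 1) := fun n => rfl
  have hα' : ∀ n, (nxt n (st n)).1.1 = α (n + 1) := fun n => rfl
  have hgη : ∀ n k, ∀ j, inner ℂ (g n) (η (n + 1 + k) j) = 0 := by
    intro n k
    induction k with
    | zero => exact hgh n (st n)
    | succ k ih => exact (hperp _ (st (n + 1 + k)) (g n) ih).2
  have hgg : ∀ m n, m < n → inner ℂ (g m) (g n) = 0 := by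
    intro m n hmn
    obtain ⟨k, rfl⟩ : ∃ k, n = m + 1 + k := ⟨n - (m + 1), by omega⟩
    exact (hperp _ (st (m + 1 + k)) (g m) (hgη m k)).1
  have hgo : Orthonormal ℂ g := by
    refine ⟨fun n => hg1 _ _, fun m n hmn => ?_⟩
    rcases lt_or_gt_of_ne hmn with h | h
    · exact hgg m n h
    · exact inner_eq_zero_symm.mp (hgg n m h)
  have hspan' : ∀ n (V : Submodule ℂ H) (j : ℕ), (∀ k < n, g k ∈ V) → (∀ p ≤ j, η n p ∈ V) →
      f j ∈ V := by
    intro n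
    induction n with
    | zero => exact fun V j _ h => h j le_rfl
    | succ n ih =>
      intro V j h1 h2
      refine ih V j (fun k hk => h1 k (by omega)) fun p hp => ?_
      exact hspan n (st n) V p (h1 n (by omega)) fun q hq => h2 q (hq.trans hp)
  -- Telescoped over the steps: the values still present at stage `n` are controlled by the gap
  -- between partial sums of `a` and `ξ`.
  have hsum' : ∀ n M, ∑ j ∈ Finset.range M, α n j + ∑ j ∈ Finset.range n, ξ j ≤
      ∑ j ∈ Finset.range (M + n), a j := by
    intro n
    induction n with
    | zero => intro M; simp [hα, st]
    | succ n ih =>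
      intro M
      rw [Finset.sum_range_succ]
      have h1 := hsum n (st n) M
      have h2 := ih (M + 1)
      rw [hα'] at h1
      rw [show M + (n + 1) = M + 1 + n by ring]
      simp only [hα] at h2 h1 ⊢
      linarith
  have hmem : ∀ j, f j ∈ (Submodule.span ℂ (Set.range g)).topologicalClosure := by
    intro j
    rw [← SetLike.mem_coe, Submodule.topologicalClosure_coe, Metric.mem_closure_iff]
    intro ε hε
    -- Chosen so that each of the `j + 1` coefficients, at most `√(α n p / a j)`, is below `ε / (j +
    -- 1)`.
    set C : ℝ := a j * (ε / (j + 1)) ^ 2 with hC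
    have hC0 : 0 < C := mul_pos (ha0 j) (by positivity)
    obtain ⟨n, hn⟩ : ∃ n, ∑ p ∈ Finset.range (j + 1), α n p < C := by
      obtain ⟨n₀, hn₀⟩ := eventually_atTop.mp (hξlim.eventually
        (gt_mem_nhds (show 0 < C / 2 / (j + 1) by positivity)))
      -- Half of `C` is spent on the gap at `n = k + (j + 1)`, the other half on the `j + 1` terms
      -- of `ξ` just before `n`, since only `k` recursion steps are made.
      obtain ⟨n, hn, hlt⟩ := hclose (C / 2) (by positivity) (n₀ + (j + 1))
      obtain ⟨k, rfl⟩ : ∃ k, n = k + (j + 1) := ⟨n - (j + 1), by omega⟩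
      refine ⟨k, ?_⟩
      have h1 := hsum' k (j + 1)
      rw [Finset.sum_sub_distrib, Finset.sum_range_add ξ] at hlt
      have h2 : ∑ p ∈ Finset.range (j + 1), ξ (k + p) ≤
          ∑ p ∈ Finset.range (j + 1), C / 2 / ((j : ℝ) + 1) :=
        Finset.sum_le_sum fun p _ => (hn₀ _ (by omega)).le
      have h3 : ∑ p ∈ Finset.range (j + 1), C / 2 / ((j : ℝ) + 1) = C / 2 := by
        rw [Finset.sum_const, Finset.card_range, nsmul_eq_mul]
        push_cast
        field_simp
      rw [add_comm (j + 1) k] at h1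
      linarith
    have hfV := hspan' n (Submodule.span ℂ (g '' Set.Iio n) ⊔
      Submodule.span ℂ (η n '' (Finset.range (j + 1) : Set ℕ))) j
      (fun k hk => Submodule.mem_sup_left (Submodule.subset_span ⟨k, hk, rfl⟩))
      (fun p hp => Submodule.mem_sup_right
        (Submodule.subset_span ⟨p, by simpa using Nat.lt_succ_of_le hp, rfl⟩))
    obtain ⟨u, hu, w, hw, huw⟩ := Submodule.mem_sup.mp hfV
    refine ⟨u, Submodule.span_mono (Set.image_subset_range _ _) hu, ?_⟩
    rw [Submodule.mem_span_image_finset_iff_exists_fun'] at hw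
    obtain ⟨c, rfl⟩ := hw
    have hηo : Orthonormal ℂ (η n) := (st n).2.orthonormal
    have hηu : ∀ p, inner ℂ (η n p) u = 0 := by
      intro p
      have : Submodule.span ℂ (g '' Set.Iio n) ≤ (Submodule.span ℂ {η n p})ᗮ := by
        rw [Submodule.span_le]
        rintro _ ⟨k, hk, rfl⟩
        rw [SetLike.mem_coe, Submodule.mem_orthogonal_singleton_iff_inner_left]
        obtain ⟨l, rfl⟩ : ∃ l, n = k + 1 + l := ⟨n - (k + 1), by have := Set.mem_Iio.mp hk; omega⟩
        exact hgη k l p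
      exact Submodule.mem_orthogonal_singleton_iff_inner_right.mp (this hu)
    have hc : ∀ p ∈ Finset.range (j + 1), ‖c p‖ ≤ √(α n p / a j) := by
      intro p hp
      have h1 : inner ℂ (η n p) (f j) = c p := by
        rw [← huw, inner_add_right, hηu, zero_add, hηo.inner_right_sum c hp]
      have h2 := eigenvalue_mul_norm_inner_sq_le hA (hf.1 j) (hAf j) (η n p)
      rw [← inner_conj_symm, h1, (st n).2.inner_apply p p] at h2
      simp only [if_true, Complex.ofReal_re, RCLike.norm_conj] at h2
      refine Real.le_sqrt_of_sq_le ?_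
      rw [le_div_iff₀ (ha0 j)]
      linarith
    have hc' : ∀ p ∈ Finset.range (j + 1), ‖c p • η n p‖ < ε / (j + 1) := by
      intro p hp
      rw [norm_smul, hηo.1 p, mul_one]
      refine (hc p hp).trans_lt ?_
      rw [Real.sqrt_lt' (by positivity), div_lt_iff₀ (ha0 j)]
      have h1 : α n p ≤ ∑ p ∈ Finset.range (j + 1), α n p :=
        Finset.single_le_sum (fun q _ => (st n).2.nonneg q) hp
      rw [mul_comm]
      exact h1.trans_lt hn
    rw [dist_eq_norm, ← huw, add_sub_cancel_left]
    calc ‖∑ p ∈ Finset.range (j + 1), c p • η n p‖ ≤ ∑ p ∈ Finset.range (j + 1), ‖c p • η n p‖ :=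
          norm_sum_le _ _
      _ < ∑ p ∈ Finset.range (j + 1), ε / ((j : ℝ) + 1) :=
          Finset.sum_lt_sum_of_nonempty ⟨0, by simp⟩ hc'
      _ = ε := by
          rw [Finset.sum_const, Finset.card_range, nsmul_eq_mul]
          push_cast
          field_simp
  have hgsp : ⊤ ≤ (Submodule.span ℂ (Set.range g)).topologicalClosure :=
    hfsp.trans (Submodule.topologicalClosure_minimal _
      (Submodule.span_le.mpr (Set.range_subset_iff.mpr hmem)) (Submodule.isClosed_topologicalClosure _))
  refine ⟨HilbertBasis.mk hgo hgsp, fun k => ?_⟩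
  rw [HilbertBasis.coe_mk]
  exact hgA _ _

end Operators

/-! ### Spectral theorem, s-numbers and Schur's inequality -/

section Eigenbasis

variable {H : Type*} [NormedAddCommGroup H] [InnerProductSpace ℂ H]

theorem tendsto_inner_orthonormal {u : ℕ → H} (hu : Orthonormal ℂ u) (x : H) :
    Tendsto (fun k => (inner ℂ x (u k) : ℂ)) atTop (𝓝 0) := by
  have h1 := (hu.inner_products_summable x).tendsto_atTop_zero
  rw [tendsto_zero_iff_norm_tendsto_zero]
  have h2 := h1.sqrt
  simp only [Real.sqrt_sq (norm_nonneg _), Real.sqrt_zero] at h2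
  refine h2.congr fun k => norm_inner_symm _ _

variable [CompleteSpace H]

/-- An orthonormal sequence is weakly null, so every norm limit point of its image is zero, and
compactness supplies such limit points along subsequences. -/
theorem tendsto_apply_orthonormal {T : H →L[ℂ] H} (hT : IsCompactOperator T) {u : ℕ → H}
    (hu : Orthonormal ℂ u) : Tendsto (fun k => T (u k)) atTop (𝓝 0) := by
  refine Filter.tendsto_of_subseq_tendsto fun ns hns => ?_
  have hK := IsCompactOperator.isCompact_closure_image_closedBall (f := (T : H →ₗ[ℂ] H)) hT 1
  obtain ⟨y, -, φ, hφ, hlim⟩ := hK.tendsto_subseq (x := fun k => T (u (ns k)))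
    fun k => subset_closure ⟨u (ns k), by simp [hu.1], rfl⟩
  refine ⟨φ, ?_⟩
  have h1 : Tendsto (fun k => (inner ℂ y (T (u (ns (φ k)))) : ℂ)) atTop (𝓝 (inner ℂ y y)) :=
    tendsto_const_nhds.inner hlim
  have h2 : Tendsto (fun k => (inner ℂ y (T (u (ns (φ k)))) : ℂ)) atTop (𝓝 0) := by
    have h3 := (tendsto_inner_orthonormal hu (ContinuousLinearMap.adjoint T y)).comp
      (hns.comp hφ.tendsto_atTop)
    refine h3.congr fun k => ?_
    simp [ContinuousLinearMap.adjoint_inner_left]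
  have hy : y = 0 := inner_self_eq_zero.mp (tendsto_nhds_unique h1 h2)
  rw [hy] at hlim
  exact hlim

theorem tendsto_inner_apply_orthonormal {T : H →L[ℂ] H} (hT : IsCompactOperator T) {u : ℕ → H}
    (hu : Orthonormal ℂ u) : Tendsto (fun k => (inner ℂ (u k) (T (u k))).re) atTop (𝓝 0) := by
  have h1 := (tendsto_apply_orthonormal hT hu).norm
  rw [norm_zero] at h1
  refine squeeze_zero_norm (fun k => ?_) h1
  rw [Real.norm_eq_abs]
  refine (Complex.abs_re_le_norm _).trans ((norm_inner_le_norm _ _).trans ?_)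
  rw [hu.1 k, one_mul]

/-- The orthonormal basis `b` diagonalizes `T`, with the nonnegative eigenvalues `a`. -/
structure IsEigenbasis {ι : Type*} (T : H →L[ℂ] H) (b : HilbertBasis ι ℂ H) (a : ι → ℝ) : Prop where
  apply_eq : ∀ i, T (b i) = (a i : ℂ) • b i
  nonneg : ∀ i, 0 ≤ a i

universe u v

theorem exists_hilbertBasis_subordinate {H : Type u} [NormedAddCommGroup H]
    [InnerProductSpace ℂ H] [CompleteSpace H] {κ : Type v} (E : κ → Submodule ℂ H)
    [∀ μ, CompleteSpace (E μ)] (hE : OrthogonalFamily ℂ (fun μ => E μ) fun μ => (E μ).subtypeₗᵢ)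
    (hbot : (⨆ μ, E μ)ᗮ = ⊥) :
    ∃ (ι : Type (max u v)) (b : HilbertBasis ι ℂ H) (idx : ι → κ), ∀ i, b i ∈ E (idx i) := by
  have hbasis := fun μ : κ => exists_hilbertBasis ℂ (E μ)
  choose w b hb using hbasis
  have ho : Orthonormal ℂ fun p : Σ μ, w μ => (b p.1 p.2 : H) :=
    hE.orthonormal_sigma_orthonormal (v_family := fun μ => b μ) fun μ => (b μ).orthonormal
  have hle : ∀ x, (∀ p : Σ μ, w μ, (inner ℂ x (b p.1 p.2 : H) : ℂ) = 0) →
      (⨆ μ, E μ) ≤ (Submodule.span ℂ {x})ᗮ := by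
    intro x hx
    refine iSup_le fun μ y hy => ?_
    rw [Submodule.mem_orthogonal_singleton_iff_inner_right]
    have h1 := ((b μ).hasSum_repr ⟨y, hy⟩).mapL (E μ).subtypeL
    have h2 := h1.mapL (innerSL ℂ x)
    refine h2.unique ?_
    have h3 : ∀ i : w μ, (innerSL ℂ x) ((E μ).subtypeL (((b μ).repr ⟨y, hy⟩ i) • b μ i)) = 0 := by
      intro i
      rw [map_smul, map_smul, innerSL_apply_apply]
      exact (congrArg _ (hx ⟨μ, i⟩)).trans (smul_zero _)
    simp only [h3]
    exact hasSum_zero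
  have hbot' : (Submodule.span ℂ (Set.range fun p : Σ μ, w μ => (b p.1 p.2 : H)))ᗮ = ⊥ := by
    rw [eq_bot_iff, ← hbot]
    intro x hx
    rw [Submodule.mem_orthogonal] at hx ⊢
    intro y hy
    exact inner_eq_zero_symm.mp (Submodule.mem_orthogonal_singleton_iff_inner_right.mp
      (hle x (fun p => inner_eq_zero_symm.mp (hx _ (Submodule.subset_span ⟨p, rfl⟩))) hy))
  refine ⟨Σ μ, w μ, HilbertBasis.mkOfOrthogonalEqBot ho hbot', fun p => p.1, fun p => ?_⟩
  rw [HilbertBasis.coe_mkOfOrthogonalEqBot]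
  exact (b p.1 p.2).2

open scoped ComplexOrder in
theorem exists_isEigenbasis {H : Type u} [NormedAddCommGroup H]
    [InnerProductSpace ℂ H] [CompleteSpace H] {T : H →L[ℂ] H} (hT : IsCompactOperator T) (hpos : T.IsPositive) :
    ∃ (ι : Type u) (b : HilbertBasis ι ℂ H) (a : ι → ℝ), IsEigenbasis T b a := by
  obtain ⟨ι, b, μ, hμ⟩ := exists_hilbertBasis_subordinate
    (Module.End.eigenspace (T : H →ₗ[ℂ] H)) hpos.isSymmetric.orthogonalFamily_eigenspaces
    (ContinuousLinearMap.orthogonalComplement_iSup_eigenspaces_eq_bot hT hpos.isSymmetric)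
  have happ : ∀ i, T (b i) = μ i • b i := fun i => Module.End.mem_eigenspace_iff.mp (hμ i)
  have hval : ∀ i, 0 ≤ μ i := by
    intro i
    have h1 := hpos.inner_nonneg_right (b i)
    rw [happ, inner_smul_right, inner_self_eq_norm_sq_to_K, b.orthonormal.1] at h1
    simpa using h1
  refine ⟨ι, b, fun i => (μ i).re, fun i => ?_, fun i => (Complex.le_def.mp (hval i)).1⟩
  rw [happ]
  congr 1
  exact Complex.eq_re_of_ofReal_le (r := 0) (by simpa using hval i)

variable {ι : Type*} {T : H →L[ℂ] H} {b : HilbertBasis ι ℂ H} {a : ι → ℝ}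

theorem hilbertBasis_ext (b : HilbertBasis ι ℂ H) {x y : H}
    (h : ∀ i, (inner ℂ (b i) x : ℂ) = inner ℂ (b i) y) : x = y := by
  refine b.repr.injective ?_
  ext i
  rw [b.repr_apply_apply, b.repr_apply_apply, h]

theorem hasSum_norm_inner_sq (b : HilbertBasis ι ℂ H) (x : H) :
    HasSum (fun i => ‖(inner ℂ (b i) x : ℂ)‖ ^ 2) (‖x‖ ^ 2) := by
  have h := Complex.hasSum_re (b.hasSum_inner_mul_inner x x)
  rw [inner_self_eq_norm_sq_to_K] at h
  convert h using 1
  · ext i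
    rw [← inner_conj_symm x (b i), Complex.conj_mul', ← Complex.ofReal_pow, Complex.ofReal_re]
  · exact (by norm_cast : ((‖x‖ : ℂ) ^ 2).re = ‖x‖ ^ 2).symm

namespace IsEigenbasis

theorem hasSum_inner (h : IsEigenbasis T b a) (x y : H) :
    HasSum (fun i => inner ℂ x (b i) * ((a i : ℂ) * inner ℂ (b i) y)) (inner ℂ x (T y)) := by
  have h1 := (b.hasSum_repr y).mapL T
  have h2 := h1.mapL (innerSL ℂ x)
  rw [innerSL_apply_apply] at h2
  have h3 : (fun i => inner ℂ x (b i) * ((a i : ℂ) * inner ℂ (b i) y)) =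
      fun i => (innerSL ℂ x) (T ((b.repr y i : ℂ) • b i)) := by
    funext i
    rw [map_smul, map_smul, h.apply_eq, innerSL_apply_apply, inner_smul_right, b.repr_apply_apply,
      smul_eq_mul]
    ring
  rw [h3]
  exact h2

theorem hasSum_re_inner (h : IsEigenbasis T b a) (x : H) :
    HasSum (fun i => a i * ‖(inner ℂ (b i) x : ℂ)‖ ^ 2) (inner ℂ x (T x)).re := by
  convert Complex.hasSum_re (h.hasSum_inner x x) using 1
  ext i
  rw [mul_left_comm, ← inner_conj_symm x (b i), Complex.conj_mul', ← Complex.ofReal_pow,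
    ← Complex.ofReal_mul, Complex.ofReal_re]

theorem isSymmetric (h : IsEigenbasis T b a) : (T : H →ₗ[ℂ] H).IsSymmetric := by
  intro x y
  have h1 := h.hasSum_inner x y
  have h2 := (h.hasSum_inner y x).star
  refine HasSum.unique ?_ h1
  simp only [ContinuousLinearMap.coe_coe]
  rw [← inner_conj_symm, starRingEnd_apply]
  convert h2 using 1
  funext i
  rw [← starRingEnd_apply, map_mul, map_mul, inner_conj_symm, inner_conj_symm, Complex.conj_ofReal]
  ring

theorem isPositive (h : IsEigenbasis T b a) : T.IsPositive := by
  refine ⟨h.isSymmetric, fun x => ?_⟩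
  rw [ContinuousLinearMap.reApplyInnerSelf_apply, ← inner_conj_symm, RCLike.conj_re]
  exact (h.hasSum_re_inner x).nonneg fun i => mul_nonneg (h.nonneg i) (sq_nonneg _)

theorem inner_apply (h : IsEigenbasis T b a) (i : ι) (x : H) :
    (inner ℂ (b i) (T x) : ℂ) = a i * inner ℂ (b i) x := by
  have h1 := h.isSymmetric (b i) x
  simp only [ContinuousLinearMap.coe_coe] at h1
  rw [← h1, h.apply_eq, inner_smul_left, Complex.conj_ofReal]

theorem apply_eq_zero_iff (h : IsEigenbasis T b a) (x : H) :
    T x = 0 ↔ ∀ i, 0 < a i → (inner ℂ (b i) x : ℂ) = 0 := by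
  constructor
  · intro hx i hi
    have h1 := h.inner_apply i x
    rw [hx, inner_zero_right] at h1
    exact (mul_eq_zero.mp h1.symm).resolve_left (by exact_mod_cast hi.ne')
  · intro hx
    refine hilbertBasis_ext b fun i => ?_
    rw [h.inner_apply, inner_zero_right]
    rcases (h.nonneg i).eq_or_lt with h0 | h0
    · simp [← h0]
    · rw [hx i h0, mul_zero]

theorem finite_setOf_le (h : IsEigenbasis T b a) (hT : IsCompactOperator T) {t : ℝ} (ht : 0 < t) :
    {i | t ≤ a i}.Finite := by
  by_contra hinf
  have hinf' : Infinite {i | t ≤ a i} := Set.infinite_coe_iff.mpr hinf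
  have hu : Orthonormal ℂ fun k => b (Infinite.natEmbedding {i | t ≤ a i} k : ι) :=
    b.orthonormal.comp _ (Subtype.val_injective.comp (Infinite.natEmbedding _).injective)
  obtain ⟨k, hk⟩ := ((tendsto_inner_apply_orthonormal hT hu).eventually (gt_mem_nhds ht)).exists
  rw [h.inner_apply, inner_self_eq_norm_sq_to_K, b.orthonormal.1] at hk
  simp only [RCLike.ofReal_one, one_pow, mul_one, Complex.ofReal_re] at hk
  exact absurd (Infinite.natEmbedding {i | t ≤ a i} k).2 (not_le.mpr hk)

theorem exists_enum (h : IsEigenbasis T b a) (hT : IsCompactOperator T)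
    (hinf : {i | 0 < a i}.Infinite) :
    ∃ σ : ℕ → ι, Function.Injective σ ∧ Antitone (a ∘ σ) ∧ (∀ k, 0 < a (σ k)) ∧
      ∀ i, 0 < a i → i ∈ Set.range σ :=
  exists_antitone_enum a hinf fun _ ht => h.finite_setOf_le hT ht

theorem finiteDimensional_range (h : IsEigenbasis T b a) (hfin : {i | 0 < a i}.Finite) :
    FiniteDimensional ℂ (LinearMap.range (T : H →ₗ[ℂ] H)) := by
  have := FiniteDimensional.span_of_finite ℂ (hfin.image b)
  refine Submodule.finiteDimensional_of_le (S₂ := Submodule.span ℂ (b '' {i | 0 < a i})) ?_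
  rintro _ ⟨x, rfl⟩
  have h1 : T x = ∑ i ∈ hfin.toFinset, ((a i : ℂ) * inner ℂ (b i) x) • b i := by
    refine (b.hasSum_repr (T x)).unique ?_
    have h2 := hasSum_sum_of_ne_finset_zero (L := .unconditional _) (f := fun i => (b.repr (T x) i : ℂ) • b i)
      (s := hfin.toFinset) fun i hi => by
        have h0 : a i = 0 := le_antisymm (not_lt.mp (by simpa using hi)) (h.nonneg i)
        simp [b.repr_apply_apply, h.inner_apply, h0]
    simpa only [b.repr_apply_apply, h.inner_apply] using h2
  simp only [ContinuousLinearMap.coe_coe]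
  rw [h1]
  exact Submodule.sum_mem _ fun i hi => Submodule.smul_mem _ _
    (Submodule.subset_span ⟨i, by simpa using hi, rfl⟩)

theorem iSup_eigenspace (h : IsEigenbasis T b a) {t : ℝ} (hfin : {i | t ≤ a i}.Finite) :
    (⨆ μ : ℝ, ⨆ _ : t ≤ μ, Module.End.eigenspace (T : Module.End ℂ H) (μ : ℂ) : Submodule ℂ H) =
      Submodule.span ℂ (b '' {i | t ≤ a i}) := by
  refine le_antisymm (iSup₂_le fun μ hμ x hx => ?_) ?_
  · have hx' : T x = (μ : ℂ) • x := Module.End.mem_eigenspace_iff.mp hx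
    have h1 : x = ∑ i ∈ hfin.toFinset, (b.repr x i : ℂ) • b i := by
      refine (b.hasSum_repr x).unique (hasSum_sum_of_ne_finset_zero fun i hi => ?_)
      have hne : a i ≠ μ := fun he => hi (by simpa [he] using hμ)
      have h2 := h.inner_apply i x
      rw [hx', inner_smul_right] at h2
      have h3 : ((a i : ℂ) - μ) * inner ℂ (b i) x = 0 := by rw [sub_mul, h2, sub_self]
      have h4 : (a i : ℂ) - μ ≠ 0 := sub_ne_zero.mpr (by exact_mod_cast hne)
      rw [b.repr_apply_apply, (mul_eq_zero.mp h3).resolve_left h4, zero_smul]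
    rw [h1]
    exact Submodule.sum_mem _ fun i hi => Submodule.smul_mem _ _
      (Submodule.subset_span ⟨i, by simpa using hi, rfl⟩)
  · rw [Submodule.span_le]
    rintro _ ⟨i, hi, rfl⟩
    exact Submodule.mem_iSup_of_mem (a i) (Submodule.mem_iSup_of_mem hi
      (Module.End.mem_eigenspace_iff.mpr (h.apply_eq i)))

theorem abs_eq (h : IsEigenbasis T b a) : CFC.abs T = T :=
  CFC.abs_of_nonneg T ((ContinuousLinearMap.nonneg_iff_isPositive T).mpr h.isPositive)

theorem sNumbers_eq (h : IsEigenbasis T b a) (hT : IsCompactOperator T) {σ : ℕ → ι}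
    (hinj : Function.Injective σ) (hanti : Antitone (a ∘ σ)) (hpos : ∀ k, 0 < a (σ k))
    (hsurj : ∀ i, 0 < a i → i ∈ Set.range σ) (n : ℕ) : sNumbers T n = a (σ n) := by
  classical
  -- For `t > 0` the dimension counts the `i` with `t ≤ a i`; it exceeds `n` exactly when `t` is at
  -- most the `n`-th enumerated value.
  have key : {t : ℝ | 0 < t ∧ (n : Cardinal) <
      Module.rank ℂ (⨆ μ : ℝ, ⨆ _ : t ≤ μ,
        Module.End.eigenspace ((CFC.abs T : H →L[ℂ] H) : Module.End ℂ H) (μ : ℂ) :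
          Submodule ℂ H)} = Set.Ioc 0 (a (σ n)) := by
    ext t
    simp only [Set.mem_ofPred_eq, Set.mem_Ioc]
    refine and_congr_right fun ht => ?_
    have hfin := h.finite_setOf_le hT ht
    rw [h.abs_eq, h.iSup_eigenspace hfin]
    have hli : LinearIndepOn ℂ id (b '' {i | t ≤ a i}) :=
      b.orthonormal.linearIndependent.linearIndepOn_id.mono (Set.image_subset_range _ _)
    have hcoe : b '' {i | t ≤ a i} = ((hfin.toFinset.image b : Finset H) : Set H) := by simp
    rw [rank_span_set hli, hcoe]
    simp only [Finset.coe_sort_coe]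
    rw [Cardinal.mk_coe_finset,
      Finset.card_image_of_injective _ b.orthonormal.linearIndependent.injective, Nat.cast_lt]
    constructor
    · intro hlt
      by_contra hcon
      have hsub : hfin.toFinset ⊆ (Finset.range n).image σ := by
        intro i hi
        have hi' : t ≤ a i := by simpa using hi
        obtain ⟨k, rfl⟩ := hsurj i (ht.trans_le hi')
        rw [Finset.mem_image]
        refine ⟨k, Finset.mem_range.mpr ?_, rfl⟩
        by_contra hk
        exact hcon (hi'.trans (hanti (not_lt.mp hk)))
      have := (Finset.card_le_card hsub).trans Finset.card_image_le
      simp only [Finset.card_range] at this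
      omega
    · intro hle
      have hsub : (Finset.range (n + 1)).image σ ⊆ hfin.toFinset := by
        intro i hi
        obtain ⟨k, hk, rfl⟩ := Finset.mem_image.mp hi
        have : t ≤ a (σ k) := hle.trans (hanti (Nat.lt_succ_iff.mp (Finset.mem_range.mp hk)))
        simpa using this
      have := Finset.card_le_card hsub
      rw [Finset.card_image_of_injective _ hinj, Finset.card_range] at this
      omega
  rw [sNumbers, key, csSup_Ioc (hpos n)]

/-- Expand in `b` and interchange the two sums of nonnegative terms; Parseval then sums over `e`. -/
theorem tsum_re_inner_conj (h : IsEigenbasis T b a) {κ : Type*} (e : HilbertBasis κ ℂ H)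
    (V : H →L[ℂ] H) :
    ∑' k, ENNReal.ofReal (inner ℂ (e k) ((V * T * star V) (e k))).re =
      ∑' i, ENNReal.ofReal (a i * ‖V (b i)‖ ^ 2) := by
  have h1 : ∀ k, ENNReal.ofReal (inner ℂ (e k) ((V * T * star V) (e k))).re =
      ∑' i, ENNReal.ofReal (a i * ‖(inner ℂ (e k) (V (b i)) : ℂ)‖ ^ 2) := by
    intro k
    have h2 := h.hasSum_re_inner (star V (e k))
    have h3 : (inner ℂ (star V (e k)) (T (star V (e k))) : ℂ) =
        inner ℂ (e k) ((V * T * star V) (e k)) := by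
      rw [ContinuousLinearMap.star_eq_adjoint, ContinuousLinearMap.adjoint_inner_left]
      rfl
    rw [← h3, ← h2.tsum_eq, ENNReal.ofReal_tsum_of_nonneg
      (fun i => mul_nonneg (h.nonneg i) (sq_nonneg _)) h2.summable]
    refine tsum_congr fun i => ?_
    rw [ContinuousLinearMap.star_eq_adjoint, ContinuousLinearMap.adjoint_inner_right,
      norm_inner_symm]
  simp only [h1]
  rw [ENNReal.tsum_comm]
  refine tsum_congr fun i => ?_
  simp only [ENNReal.ofReal_mul (h.nonneg i)]
  rw [ENNReal.tsum_mul_left]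
  have h4 := hasSum_norm_inner_sq e (V (b i))
  rw [← h4.tsum_eq, ENNReal.ofReal_tsum_of_nonneg (fun k => sq_nonneg _) h4.summable]

/-- The partial sums of the diagonal of `V T V*` are dominated by those of the eigenvalues of `T`,
with a defect controlled by the norms of the vectors `V* u k`. -/
theorem sum_re_inner_conj_le (h : IsEigenbasis T b a) {σ : ℕ → ι} (hinj : Function.Injective σ)
    (hanti : Antitone (a ∘ σ)) (hpos : ∀ k, 0 < a (σ k))
    (hsurj : ∀ i, 0 < a i → i ∈ Set.range σ) {V : H →L[ℂ] H} (hV : ∀ x, ‖V x‖ ≤ ‖x‖)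
    {u : ℕ → H} (hu : Orthonormal ℂ u) (n : ℕ) :
    ∑ k ∈ Finset.range n, (inner ℂ (u k) ((V * T * star V) (u k))).re +
      a (σ n) * (n - ∑ k ∈ Finset.range n, ‖star V (u k)‖ ^ 2) ≤
      ∑ j ∈ Finset.range n, a (σ j) := by
  classical
  -- Weight of eigenvalue `i` in the partial sum: Bessel bounds it by one, and the total weight is
  -- the sum of the `‖V* u k‖ ^ 2`.
  set c : ι → ℝ := fun i => ∑ k ∈ Finset.range n, ‖(inner ℂ (b i) (star V (u k)) : ℂ)‖ ^ 2 with hc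
  have hc0 : ∀ i, 0 ≤ c i := fun i => Finset.sum_nonneg fun k _ => sq_nonneg _
  have hc1 : ∀ i, c i ≤ 1 := by
    intro i
    have h1 := hu.sum_inner_products_le (V (b i)) (s := Finset.range n)
    have h2 : ‖V (b i)‖ ^ 2 ≤ 1 := by
      have := hV (b i)
      rw [b.orthonormal.1 i] at this
      exact pow_le_one₀ (norm_nonneg _) this
    refine (le_of_eq (Finset.sum_congr rfl fun k _ => ?_)).trans (h1.trans h2)
    rw [ContinuousLinearMap.star_eq_adjoint, ContinuousLinearMap.adjoint_inner_right,
      norm_inner_symm]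
  have hcs : HasSum c (∑ k ∈ Finset.range n, ‖star V (u k)‖ ^ 2) :=
    hasSum_sum fun k _ => hasSum_norm_inner_sq b (star V (u k))
  have hac : HasSum (fun i => a i * c i)
      (∑ k ∈ Finset.range n, (inner ℂ (u k) ((V * T * star V) (u k))).re) := by
    simp only [hc, Finset.mul_sum]
    refine hasSum_sum fun k _ => ?_
    convert h.hasSum_re_inner (star V (u k)) using 2
    rw [ContinuousLinearMap.star_eq_adjoint, ContinuousLinearMap.adjoint_inner_left]
    rfl
  set S : Finset ι := (Finset.range n).image σ
  have hS : HasSum (fun i => if i ∈ S then a i - a (σ n) else 0) (∑ i ∈ S, (a i - a (σ n))) := by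
    have h1 := hasSum_sum_of_ne_finset_zero (L := .unconditional _) (f := fun i => if i ∈ S then a i - a (σ n) else 0)
      (s := S) fun i hi => by simp [hi]
    convert h1 using 1
    exact Finset.sum_congr rfl fun i hi => by simp [hi]
  -- After subtracting the threshold `a (σ n)`, the factor of `c i` is nonnegative on the first `n`
  -- indices, where `c i ≤ 1`, and nonpositive elsewhere.
  have hle := hasSum_le (fun i => ?_) (hac.sub (hcs.mul_left (a (σ n)))) hS
  · rw [Finset.sum_image hinj.injOn, Finset.sum_sub_distrib, Finset.sum_const, Finset.card_range,
      nsmul_eq_mul] at hle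
    linarith
  · rw [← sub_mul]
    split_ifs with hi
    · obtain ⟨k, hk, rfl⟩ := Finset.mem_image.mp hi
      have h1 : a (σ n) ≤ a (σ k) := hanti (Finset.mem_range.mp hk).le
      nlinarith [hc1 (σ k)]
    · have h1 : a i ≤ a (σ n) := by
        rcases (h.nonneg i).eq_or_lt with h0 | h0
        · exact h0 ▸ (hpos n).le
        · obtain ⟨k, rfl⟩ := hsurj i h0
          refine hanti (not_lt.mp fun hk => hi (Finset.mem_image_of_mem σ (Finset.mem_range.mpr hk)))
      exact mul_nonpos_of_nonpos_of_nonneg (by linarith) (hc0 i)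

end IsEigenbasis

end Eigenbasis

/-! ### Range projections and kernels -/

section RangeProjection

variable {H : Type*} [NormedAddCommGroup H] [InnerProductSpace ℂ H] [CompleteSpace H]

theorem mem_orthogonal_range_iff {T : H →L[ℂ] H} (hT : T.IsPositive) (x : H) :
    x ∈ (LinearMap.range (T : H →ₗ[ℂ] H)).topologicalClosureᗮ ↔ T x = 0 := by
  rw [Submodule.orthogonal_closure, ContinuousLinearMap.orthogonal_range,
    hT.isSelfAdjoint.adjoint_eq]
  rfl

theorem rangeProj_apply_eq_zero {T : H →L[ℂ] H} (hT : T.IsPositive) {x : H} (hx : T x = 0) :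
    rangeProj T x = 0 :=
  (Submodule.starProjection_apply_eq_zero_iff _).mpr ((mem_orthogonal_range_iff hT x).mpr hx)

theorem rangeProj_apply_apply (T : H →L[ℂ] H) (x : H) : rangeProj T (T x) = T x :=
  Submodule.starProjection_eq_self_iff.mpr
    (Submodule.le_topologicalClosure _ (LinearMap.mem_range_self (T : H →ₗ[ℂ] H) x))

theorem apply_rangeProj {T : H →L[ℂ] H} (hT : T.IsPositive) (x : H) :
    T (rangeProj T x) = T x := by
  have h1 : x - rangeProj T x ∈ (LinearMap.range (T : H →ₗ[ℂ] H)).topologicalClosureᗮ :=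
    Submodule.sub_starProjection_mem_orthogonal x
  rw [mem_orthogonal_range_iff hT, map_sub, sub_eq_zero] at h1
  exact h1.symm

theorem rangeProj_eq_one_iff {T : H →L[ℂ] H} (hT : T.IsPositive) :
    rangeProj T = 1 ↔ ∀ x, T x = 0 → x = 0 := by
  constructor
  · intro h x hx
    have h1 := rangeProj_apply_eq_zero hT hx
    rwa [h] at h1
  · intro h
    ext x
    have h1 := h (x - rangeProj T x) (by rw [map_sub, apply_rangeProj hT, sub_self])
    exact (sub_eq_zero.mp h1).symm

theorem supportProj_eq_rangeProj {T : H →L[ℂ] H} (hT : T.IsPositive) :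
    supportProj T = rangeProj T := by
  have h1 : star T = T := hT.isSelfAdjoint
  simp only [supportProj, rangeProj, h1, sup_idem]

variable {ι : Type*} {T : H →L[ℂ] H} {b : HilbertBasis ι ℂ H} {a : ι → ℝ}

theorem IsEigenbasis.rangeProj_eq_one_iff (h : IsEigenbasis T b a) :
    rangeProj T = 1 ↔ ∀ i, 0 < a i := by
  rw [SchurHorn.rangeProj_eq_one_iff h.isPositive]
  constructor
  · intro hx i
    refine (h.nonneg i).lt_of_ne fun h0 => ?_
    have h1 := hx (b i) (by rw [h.apply_eq, ← h0, Complex.ofReal_zero, zero_smul])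
    have h2 := b.orthonormal.1 i
    rw [h1, norm_zero] at h2
    exact zero_ne_one h2
  · intro hpos x hx
    refine hilbertBasis_ext b fun i => ?_
    rw [inner_zero_right]
    exact (h.apply_eq_zero_iff x).mp hx i (hpos i)

/-- This makes the trace of the complementary projection the number of zero eigenvalues. -/
theorem IsEigenbasis.one_sub_rangeProj [DecidablePred fun i => a i = 0] (h : IsEigenbasis T b a) :
    IsEigenbasis (1 - rangeProj T) b fun i => if a i = 0 then 1 else 0 := by
  refine ⟨fun i => ?_, fun i => by split_ifs <;> norm_num⟩
  rw [sub_apply, one_apply_eq_self]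
  split_ifs with h0
  · rw [rangeProj_apply_eq_zero h.isPositive (by rw [h.apply_eq, h0, Complex.ofReal_zero, zero_smul])]
    simp
  · have h1 : b i = T (((a i : ℂ)⁻¹) • b i) := by
      rw [map_smul, h.apply_eq, smul_smul, inv_mul_cancel₀ (by exact_mod_cast h0), one_smul]
    rw [h1, rangeProj_apply_apply, ← h1]
    simp

theorem IsEigenbasis.tr_eq (h : IsEigenbasis T b a) (e : HilbertBasis ℕ ℂ H) :
    tr e T = ∑' i, ENNReal.ofReal (a i) := by
  have h1 := h.tsum_re_inner_conj e 1
  simp only [one_mul, star_one, mul_one, one_apply_eq_self, b.orthonormal.1, one_pow]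
    at h1
  exact h1

theorem IsEigenbasis.infinite_setOf_pos (h : IsEigenbasis T b a) (e : HilbertBasis ℕ ℂ H)
    (hR : rangeProj T = 1) : {i | 0 < a i}.Infinite := by
  intro hfin
  have huniv : {i | 0 < a i} = Set.univ := Set.eq_univ_of_forall (h.rangeProj_eq_one_iff.mp hR)
  rw [huniv, Set.finite_univ_iff] at hfin
  have := Fintype.ofFinite ι
  have : FiniteDimensional ℂ H := Module.Finite.of_basis b.toOrthonormalBasis.toBasis
  exact not_finite_iff_infinite.mpr inferInstance e.orthonormal.linearIndependent.finite

end RangeProjection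

/-! ### Diagonal operators and the conditional expectation -/

section Diagonal

variable {H : Type*} [NormedAddCommGroup H] [InnerProductSpace ℂ H] [CompleteSpace H]

theorem apply_basis_of_mem_diagonalOps {e : HilbertBasis ℕ ℂ H} {B : H →L[ℂ] H}
    (hB : B ∈ diagonalOps e) (k : ℕ) : B (e k) = (inner ℂ (e k) (B (e k)) : ℂ) • e k := by
  refine hilbertBasis_ext e fun i => ?_
  rw [inner_smul_right, orthonormal_iff_ite.mp e.orthonormal]
  split_ifs with h
  · rw [h, mul_one]
  · rw [mul_zero]
    exact hB i k h

theorem ofReal_re_inner_apply {T : H →L[ℂ] H} (hT : T.IsPositive) (x : H) :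
    (((inner ℂ x (T x) : ℂ).re : ℝ) : ℂ) = inner ℂ x (T x) := by
  rw [← Complex.conj_eq_iff_re, inner_conj_symm]
  exact hT.isSymmetric x x

theorem re_inner_apply_nonneg {T : H →L[ℂ] H} (hT : T.IsPositive) (x : H) :
    0 ≤ (inner ℂ x (T x) : ℂ).re := hT.re_inner_nonneg_right x

theorem isEigenbasis_of_mem_diagonalOps {e : HilbertBasis ℕ ℂ H} {B : H →L[ℂ] H}
    (hB : B ∈ diagonalOps e) (hpos : B.IsPositive) :
    IsEigenbasis B e fun k => (inner ℂ (e k) (B (e k)) : ℂ).re :=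
  ⟨fun k => by rw [ofReal_re_inner_apply hpos]; exact apply_basis_of_mem_diagonalOps hB k,
    fun _ => re_inner_apply_nonneg hpos _⟩

theorem expect_mem_diagonalOps (e : HilbertBasis ℕ ℂ H) (C : H →L[ℂ] H) :
    expect e C ∈ diagonalOps e := fun i j h => by rw [inner_expect_basis, if_neg h]

theorem inner_expect_self (e : HilbertBasis ℕ ℂ H) (C : H →L[ℂ] H) (k : ℕ) :
    (inner ℂ (e k) (expect e C (e k)) : ℂ) = inner ℂ (e k) (C (e k)) := by
  rw [inner_expect_basis, if_pos rfl]

theorem isEigenbasis_expect (e : HilbertBasis ℕ ℂ H) {C : H →L[ℂ] H} (hC : C.IsPositive) :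
    IsEigenbasis (expect e C) e fun k => (inner ℂ (e k) (C (e k)) : ℂ).re := by
  refine ⟨fun k => ?_, fun _ => re_inner_apply_nonneg hC _⟩
  rw [ofReal_re_inner_apply hC, apply_basis_of_mem_diagonalOps (expect_mem_diagonalOps e C),
    inner_expect_self]

theorem eq_expect_of_inner_eq {e : HilbertBasis ℕ ℂ H} {B C : H →L[ℂ] H} (hB : B ∈ diagonalOps e)
    (h : ∀ k, (inner ℂ (e k) (B (e k)) : ℂ) = inner ℂ (e k) (C (e k))) : expect e C = B := by
  refine ContinuousLinearMap.ext_on (s := Set.range e) ?_ ?_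
  · exact Submodule.dense_iff_topologicalClosure_eq_top.mpr e.dense_span
  · rintro _ ⟨k, rfl⟩
    rw [apply_basis_of_mem_diagonalOps hB, apply_basis_of_mem_diagonalOps (expect_mem_diagonalOps e C),
      inner_expect_self, h]

theorem isCompactOperator_starProjection (K : Submodule ℂ H) [FiniteDimensional ℂ K] :
    IsCompactOperator K.starProjection := by
  have : ProperSpace K := FiniteDimensional.proper ℂ K
  have h : IsCompactOperator K.orthogonalProjectionOnto :=
    isCompactOperator_of_locallyCompactSpace_dom K.orthogonalProjectionOnto
  exact h.clm_comp K.subtypeL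

/-- The diagonal entries of a compact operator tend to zero, so the finite truncations of the
diagonal operator converge in norm. -/
theorem isCompactOperator_expect (e : HilbertBasis ℕ ℂ H) {C : H →L[ℂ] H}
    (hC : IsCompactOperator C) (hpos : C.IsPositive) : IsCompactOperator (expect e C) := by
  have h := isEigenbasis_expect e hpos
  set d : ℕ → ℝ := fun k => (inner ℂ (e k) (C (e k)) : ℂ).re
  have hd : Tendsto d atTop (𝓝 0) := tendsto_inner_apply_orthonormal hC e.orthonormal
  let K : ℕ → Submodule ℂ H := fun N => Submodule.span ℂ (e '' (Finset.range N : Set ℕ))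
  have hK : ∀ N, FiniteDimensional ℂ (K N) := fun N =>
    FiniteDimensional.span_of_finite ℂ ((Finset.range N).finite_toSet.image e)
  have hlim : Tendsto (fun N => expect e C ∘L (K N).starProjection) atTop (𝓝 (expect e C)) := by
    rw [Metric.tendsto_atTop]
    intro ε hε
    obtain ⟨N, hN⟩ := eventually_atTop.mp (hd.eventually (gt_mem_nhds (half_pos hε)))
    refine ⟨N, fun n hn => ?_⟩
    rw [dist_comm, dist_eq_norm]
    refine lt_of_le_of_lt (ContinuousLinearMap.opNorm_le_bound _ (half_pos hε).le fun x => ?_)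
      (half_lt_self hε)
    set y := x - (K n).starProjection x with hy
    have hyK : y ∈ (K n)ᗮ := Submodule.sub_starProjection_mem_orthogonal x
    have hyn : ‖y‖ ≤ ‖x‖ := by
      rw [hy, ← Submodule.starProjection_orthogonal_val]
      exact (K n)ᗮ.norm_starProjection_apply_le x
    have h0 : ∀ k < n, (inner ℂ (e k) y : ℂ) = 0 := fun k hk =>
      (Submodule.mem_orthogonal _ _).mp hyK _ (Submodule.subset_span ⟨k, by simpa using hk, rfl⟩)
    have h1 : ‖expect e C y‖ ^ 2 ≤ (ε / 2 * ‖y‖) ^ 2 := by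
      rw [mul_pow]
      refine hasSum_le (fun k => ?_) (hasSum_norm_inner_sq e (expect e C y))
        ((hasSum_norm_inner_sq e y).mul_left ((ε / 2) ^ 2))
      rw [h.inner_apply, norm_mul, mul_pow]
      rcases lt_or_ge k n with hk | hk
      · simp [h0 k hk]
      · refine mul_le_mul_of_nonneg_right ?_ (sq_nonneg _)
        have h2 : ‖(d k : ℂ)‖ = d k := by
          rw [Complex.norm_real, Real.norm_of_nonneg (h.nonneg k)]
        rw [h2]
        exact pow_le_pow_left₀ (h.nonneg k) (hN k (hn.trans hk)).le 2
    have h3 := abs_le_of_sq_le_sq h1 (by positivity)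
    rw [abs_norm] at h3
    calc ‖(expect e C - expect e C ∘L (K n).starProjection) x‖ = ‖expect e C y‖ := by
          rw [hy, map_sub]; rfl
      _ ≤ ε / 2 * ‖y‖ := h3
      _ ≤ ε / 2 * ‖x‖ := by gcongr
  exact isCompactOperator_of_tendsto hlim
    (Eventually.of_forall fun N => (isCompactOperator_starProjection (K N)).clm_comp (expect e C))

theorem isPositive_conj {A : H →L[ℂ] H} (hA : A.IsPositive) (V : H →L[ℂ] H) :
    (V * A * star V).IsPositive := by
  rw [mul_assoc]
  exact hA.conj_adjoint V

theorem isCompactOperator_conj {A : H →L[ℂ] H} (hA : IsCompactOperator A) (V : H →L[ℂ] H) :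
    IsCompactOperator (V * A * star V) :=
  (hA.clm_comp V).comp_clm (star V)

theorem inner_conj_apply (A V : H →L[ℂ] H) (x : H) :
    (inner ℂ x ((V * A * star V) x) : ℂ) = inner ℂ (star V x) (A (star V x)) := by
  rw [ContinuousLinearMap.star_eq_adjoint, ContinuousLinearMap.adjoint_inner_left]
  rfl

end Diagonal

/-! ### Partial isometries and unitaries -/

section Isometries

variable {H : Type*} [NormedAddCommGroup H] [InnerProductSpace ℂ H] [CompleteSpace H]

theorem norm_apply_sq_eq_of_star_mul_self {V P : H →L[ℂ] H} (h : star V * V = P) (x : H) :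
    (‖V x‖ : ℂ) ^ 2 = inner ℂ x (P x) := by
  rw [← h, mul_apply_eq_comp, ContinuousLinearMap.star_eq_adjoint,
    ContinuousLinearMap.adjoint_inner_right]
  exact (inner_self_eq_norm_sq_to_K (𝕜 := ℂ) (V x)).symm

theorem norm_apply_of_star_mul_self_eq {V : H →L[ℂ] H} {K : Submodule ℂ H}
    [K.HasOrthogonalProjection] (h : star V * V = K.starProjection) (x : H) :
    ‖V x‖ = ‖K.starProjection x‖ := by
  have h1 := norm_apply_sq_eq_of_star_mul_self h x
  have h2 : (inner ℂ x (K.starProjection x) : ℂ) = (‖K.starProjection x‖ : ℂ) ^ 2 := by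
    have h3 := Submodule.starProjection_inner_eq_zero (K := K) x (K.starProjection x)
      (Submodule.starProjection_apply_mem K x)
    rw [inner_sub_left, sub_eq_zero] at h3
    rw [h3]
    exact inner_self_eq_norm_sq_to_K (𝕜 := ℂ) _
  rw [h2] at h1
  have h4 : ‖V x‖ ^ 2 = ‖K.starProjection x‖ ^ 2 := by exact_mod_cast h1
  exact (pow_left_inj₀ (norm_nonneg _) (norm_nonneg _) two_ne_zero).mp h4

theorem norm_star_apply_le {V : H →L[ℂ] H} (h : ∀ x, ‖V x‖ ≤ ‖x‖) (x : H) :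
    ‖star V x‖ ≤ ‖x‖ := by
  have h1 : ‖V‖ ≤ 1 := ContinuousLinearMap.opNorm_le_bound _ zero_le_one fun x => by
    rw [one_mul]; exact h x
  have h2 := (star V).le_opNorm x
  rw [norm_star] at h2
  exact h2.trans (mul_le_of_le_one_left (norm_nonneg _) h1)

theorem exists_unitary_apply_eq {κ : Type*} (g e : HilbertBasis κ ℂ H) :
    ∃ U ∈ unitary (H →L[ℂ] H), ∀ k, star U (e k) = g k := by
  classical
  let Φ : H ≃ₗᵢ[ℂ] H := g.repr.trans e.repr.symm
  have hΦ : ∀ k, Φ (g k) = e k := fun k => by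
    simp only [Φ, LinearIsometryEquiv.trans_apply, g.repr_self, e.repr_symm_single]
  refine ⟨Unitary.linearIsometryEquiv.symm Φ, (Unitary.linearIsometryEquiv.symm Φ).2, fun k => ?_⟩
  have h1 : ((Unitary.linearIsometryEquiv.symm Φ : unitary (H →L[ℂ] H)) : H →L[ℂ] H) (g k) = e k :=
    hΦ k
  have h2 := congrArg (fun S : H →L[ℂ] H => S (g k))
    (Unitary.mem_iff.mp (Unitary.linearIsometryEquiv.symm Φ).2).1
  simp only [mul_apply_eq_comp, one_apply_eq_self, h1] at h2
  exact h2

/-- Inside the finite-dimensional space `K + V K` an isometry defined on `K` extends to a bijective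
one; the identity on the orthogonal complement completes it. -/
theorem exists_unitary_extending {K : Submodule ℂ H} [FiniteDimensional ℂ K] {V : H →L[ℂ] H}
    (hV : star V * V = K.starProjection) :
    ∃ U ∈ unitary (H →L[ℂ] H), ∀ x ∈ K, U x = V x := by
  have hnorm : ∀ x ∈ K, ‖V x‖ = ‖x‖ := fun x hx => by
    rw [norm_apply_of_star_mul_self_eq hV, Submodule.starProjection_eq_self_iff.mpr hx]
  let W : Submodule ℂ H := K ⊔ K.map (V : H →ₗ[ℂ] H)
  have hKW : K ≤ W := le_sup_left
  have hVW : ∀ x ∈ K, V x ∈ W := fun x hx => Submodule.mem_sup_right ⟨x, hx, rfl⟩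
  let S : Submodule ℂ W := K.comap W.subtype
  let L : S →ₗᵢ[ℂ] W :=
    { toLinearMap := ((V : H →ₗ[ℂ] H) ∘ₗ W.subtype ∘ₗ S.subtype).codRestrict W
        fun x => hVW _ x.2
      norm_map' := fun x => hnorm _ x.2 }
  let F : W →ₗᵢ[ℂ] W := L.extend
  have hF : ∀ x (hx : x ∈ K), (F ⟨x, hKW hx⟩ : H) = V x := fun x hx =>
    congrArg Subtype.val (LinearIsometry.extend_apply L ⟨⟨x, hKW hx⟩, hx⟩)
  have hFs : Function.Surjective F :=
    LinearMap.injective_iff_surjective (f := F.toLinearMap).mp F.injective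
  let G : H →ₗ[ℂ] H := W.subtype ∘ₗ F.toLinearMap ∘ₗ (W.orthogonalProjectionOnto : H →ₗ[ℂ] W) +
    (LinearMap.id - (W.starProjection : H →ₗ[ℂ] H))
  have hG : ∀ x, G x = (F (W.orthogonalProjectionOnto x) : H) + (x - W.starProjection x) :=
    fun x => rfl
  have hGW : ∀ (w : W) (z : H), z ∈ Wᗮ → G (w + z) = F w + z := by
    intro w z hz
    have h1 : W.orthogonalProjectionOnto ((w : H) + z) = w := by
      rw [map_add, Submodule.orthogonalProjectionOnto_mem_subspace_eq_self,
        Submodule.orthogonalProjectionOnto_apply_of_mem_orthogonal hz, add_zero]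
    have h2 : W.starProjection ((w : H) + z) = w := congrArg Subtype.val h1
    rw [hG, h1, h2, add_sub_cancel_left]
  have hdec : ∀ x, ∃ (w : W) (z : H), z ∈ Wᗮ ∧ x = w + z := fun x =>
    ⟨W.orthogonalProjectionOnto x, x - W.starProjection x,
      Submodule.sub_starProjection_mem_orthogonal x, by
        rw [← Submodule.starProjection_apply, add_sub_cancel]⟩
  let Gi : H →ₗᵢ[ℂ] H :=
    { toLinearMap := G
      norm_map' := fun x => by
        obtain ⟨w, z, hz, rfl⟩ := hdec x
        rw [hGW w z hz, ← pow_left_inj₀ (norm_nonneg _) (norm_nonneg _) two_ne_zero, pow_two,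
          pow_two,
          norm_add_sq_eq_norm_sq_add_norm_sq_of_inner_eq_zero (𝕜 := ℂ) _ _
            ((Submodule.mem_orthogonal _ _).mp hz _ (F w).2),
          norm_add_sq_eq_norm_sq_add_norm_sq_of_inner_eq_zero (𝕜 := ℂ) _ _
            ((Submodule.mem_orthogonal _ _).mp hz _ w.2), Submodule.norm_coe, Submodule.norm_coe,
          F.norm_map] }
  have hGs : Function.Surjective Gi := by
    intro y
    obtain ⟨w, z, hz, rfl⟩ := hdec y
    obtain ⟨w', rfl⟩ := hFs w
    exact ⟨w' + z, hGW w' z hz⟩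
  refine ⟨Unitary.linearIsometryEquiv.symm (LinearIsometryEquiv.ofSurjective Gi hGs),
    (Unitary.linearIsometryEquiv.symm _).2, fun x hx => ?_⟩
  have h1 := hGW ⟨x, hKW hx⟩ 0 (Submodule.zero_mem _)
  simp only [add_zero] at h1
  rw [hF x hx] at h1
  exact h1

end Isometries

/-! ### Comparison of the two orbits -/

section Orbits

variable {H : Type*} [NormedAddCommGroup H] [InnerProductSpace ℂ H] [CompleteSpace H]

theorem norm_apply_of_mem_unitary {U : H →L[ℂ] H} (hU : U ∈ unitary (H →L[ℂ] H)) (x : H) :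
    ‖U x‖ = ‖x‖ :=
  (Unitary.linearIsometryEquiv ⟨U, hU⟩).norm_map x

theorem apply_star_apply_of_mem_unitary {U : H →L[ℂ] H} (hU : U ∈ unitary (H →L[ℂ] H)) (x : H) :
    U (star U x) = x := by
  have h := congrArg (fun S : H →L[ℂ] H => S x) (Unitary.mem_iff.mp hU).2
  simpa only [mul_apply_eq_comp, one_apply_eq_self] using h

theorem star_apply_apply_of_mem_unitary {U : H →L[ℂ] H} (hU : U ∈ unitary (H →L[ℂ] H)) (x : H) :
    star U (U x) = x := by
  have h := congrArg (fun S : H →L[ℂ] H => S x) (Unitary.mem_iff.mp hU).1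
  simpa only [mul_apply_eq_comp, one_apply_eq_self] using h

theorem rangeProj_mul_rangeProj (A : H →L[ℂ] H) : rangeProj A * rangeProj A = rangeProj A :=
  (LinearMap.range (A : H →ₗ[ℂ] H)).topologicalClosure.isIdempotentElem_starProjection

theorem star_rangeProj (A : H →L[ℂ] H) : star (rangeProj A) = rangeProj A :=
  (isSelfAdjoint_starProjection (LinearMap.range (A : H →ₗ[ℂ] H)).topologicalClosure)

theorem mul_rangeProj {A : H →L[ℂ] H} (hA : A.IsPositive) : A * rangeProj A = A := by
  ext x
  exact apply_rangeProj hA x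

theorem rangeProj_mul (A : H →L[ℂ] H) : rangeProj A * A = A := by
  ext x
  exact rangeProj_apply_apply A x

theorem star_mul_self_mul_rangeProj {A U : H →L[ℂ] H} (hU : U ∈ unitary (H →L[ℂ] H)) :
    star (U * rangeProj A) * (U * rangeProj A) = rangeProj A := by
  rw [star_mul, star_rangeProj, mul_assoc, ← mul_assoc (star U), (Unitary.mem_iff.mp hU).1, one_mul,
    rangeProj_mul_rangeProj]

theorem conj_mul_rangeProj {A U : H →L[ℂ] H} (hA : A.IsPositive) :
    U * rangeProj A * A * star (U * rangeProj A) = U * A * star U := by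
  rw [star_mul, star_rangeProj, mul_assoc U, rangeProj_mul, ← mul_assoc, mul_assoc U,
    mul_rangeProj hA]

theorem mul_star_mul_self_of_rangeProj {A V : H →L[ℂ] H} (hV : star V * V = rangeProj A) :
    V * star V * V = V := by
  rw [mul_assoc, hV]
  ext x
  have h1 : ‖V (x - rangeProj A x)‖ = 0 := by
    rw [norm_apply_of_star_mul_self_eq hV]
    change ‖rangeProj A (x - rangeProj A x)‖ = 0
    rw [map_sub, ← mul_apply_eq_comp, rangeProj_mul_rangeProj, sub_self, norm_zero]
  rw [norm_eq_zero, map_sub, sub_eq_zero] at h1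
  exact h1.symm

theorem unitaryOrbit_subset_partialIsometryOrbit {A : H →L[ℂ] H} (hA : A.IsPositive) :
    unitaryOrbit A ⊆ partialIsometryOrbit A := by
  rintro _ ⟨U, hU, rfl⟩
  -- Cutting `U` down to the range of `A` leaves the conjugate unchanged.
  refine ⟨U * rangeProj A, mul_star_mul_self_of_rangeProj (star_mul_self_mul_rangeProj hU), ?_,
    (conj_mul_rangeProj hA).symm⟩
  rw [supportProj_eq_rangeProj hA, star_mul_self_mul_rangeProj hU]

theorem partialIsometryOrbit_subset_unitaryOrbit {A : H →L[ℂ] H} (hA : A.IsPositive)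
    (hfin : FiniteDimensional ℂ (LinearMap.range (A : H →ₗ[ℂ] H))) :
    partialIsometryOrbit A ⊆ unitaryOrbit A := by
  rintro _ ⟨V, -, hV, rfl⟩
  rw [supportProj_eq_rangeProj hA] at hV
  have hK : FiniteDimensional ℂ (LinearMap.range (A : H →ₗ[ℂ] H)).topologicalClosure := by
    rwa [(Submodule.closed_of_finiteDimensional _).submodule_topologicalClosure_eq]
  obtain ⟨U, hU, hUV⟩ := exists_unitary_extending hV
  have hUA : U * A = V * A := by
    ext x
    exact hUV _ (Submodule.le_topologicalClosure _ (LinearMap.mem_range_self (A : H →ₗ[ℂ] H) x))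
  refine ⟨U, hU, ?_⟩
  have h1 : A * star U = A * star V := by
    have h2 := congrArg star hUA
    have h3 : star A = A := hA.isSelfAdjoint
    rwa [star_mul, star_mul, h3] at h2
  rw [hUA, mul_assoc V A (star U), h1, mul_assoc]

variable {ι : Type*} {A : H →L[ℂ] H} {b : HilbertBasis ι ℂ H} {a : ι → ℝ}

theorem IsEigenbasis.conj_unitary (h : IsEigenbasis A b a) {U : H →L[ℂ] H}
    (hU : U ∈ unitary (H →L[ℂ] H)) :
    ∃ b' : HilbertBasis ι ℂ H, IsEigenbasis (U * A * star U) b' a := by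
  classical
  refine ⟨⟨(Unitary.linearIsometryEquiv ⟨U, hU⟩).symm.trans b.repr⟩, fun i => ?_, h.nonneg⟩
  have h1 : (⟨(Unitary.linearIsometryEquiv ⟨U, hU⟩).symm.trans b.repr⟩ : HilbertBasis ι ℂ H) i =
      U (b i) := by
    rw [← b.repr_symm_single i]
    rfl
  rw [h1, mul_apply_eq_comp, mul_apply_eq_comp, star_apply_apply_of_mem_unitary hU, h.apply_eq,
    map_smul]

theorem tr_one_sub_rangeProj_expect_le (e : HilbertBasis ℕ ℂ H) (hA : IsCompactOperator A)
    (hpos : A.IsPositive) {C : H →L[ℂ] H} (hC : C ∈ unitaryOrbit A) :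
    tr e (1 - rangeProj (expect e C)) ≤ tr e (1 - rangeProj A) := by
  classical
  obtain ⟨U, hU, rfl⟩ := hC
  obtain ⟨ι, b, a, h⟩ := exists_isEigenbasis hA hpos
  obtain ⟨b', h'⟩ := h.conj_unitary hU
  set C := U * A * star U
  have hR : tr e (1 - rangeProj A) = tr e (1 - rangeProj C) := by
    rw [h.one_sub_rangeProj.tr_eq, h'.one_sub_rangeProj.tr_eq]
  have hCpos := h'.isPositive
  rw [hR, (isEigenbasis_expect e hCpos).one_sub_rangeProj.tr_eq, tr]
  -- A zero diagonal entry puts `e k` in the kernel of `C`, so it contributes a full `1` to the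
  -- trace of the kernel projection.
  refine ENNReal.tsum_le_tsum fun k => ?_
  split_ifs with hk
  · have h1 := h'.hasSum_re_inner (e k)
    rw [hk, hasSum_zero_iff_of_nonneg fun i => mul_nonneg (h.nonneg i) (sq_nonneg _)] at h1
    have h2 : C (e k) = 0 := (h'.apply_eq_zero_iff _).mpr fun i hi => by
      have h3 := (mul_eq_zero.mp (congrFun h1 i)).resolve_left hi.ne'
      exact norm_eq_zero.mp (pow_eq_zero_iff two_ne_zero |>.mp h3)
    rw [sub_apply, rangeProj_apply_eq_zero hCpos h2, sub_zero, one_apply_eq_self,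
      inner_self_eq_norm_sq_to_K, e.orthonormal.1]
    simp
  · simp

theorem tr_zero (e : HilbertBasis ℕ ℂ H) : tr e (0 : H →L[ℂ] H) = 0 := by
  simp [tr]

theorem rangeProj_eq_one_of_tr_le (e : HilbertBasis ℕ ℂ H) (h : IsEigenbasis A b a)
    {T : H →L[ℂ] H} (hT : rangeProj T = 1)
    (hle : tr e (1 - rangeProj A) ≤ tr e (1 - rangeProj T)) : rangeProj A = 1 := by
  classical
  rw [hT, sub_self, tr_zero, h.one_sub_rangeProj.tr_eq, nonpos_iff_eq_zero, ENNReal.tsum_eq_zero]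
    at hle
  refine h.rangeProj_eq_one_iff.mpr fun i => (h.nonneg i).lt_of_ne fun h0 => ?_
  have h1 := hle i
  rw [if_pos h0.symm, ENNReal.ofReal_one] at h1
  exact one_ne_zero h1

end Orbits

/-! ### Majorization criteria and the separating example -/

section Majorization

variable {H : Type*} [NormedAddCommGroup H] [InnerProductSpace ℂ H] [CompleteSpace H]

/-- A positive compact operator with dense range has an eigenbasis indexed by `ℕ` along which the
eigenvalues are its s-numbers. -/
theorem exists_isEigenbasis_sNumbers (e : HilbertBasis ℕ ℂ H) {A : H →L[ℂ] H}
    (hA : IsCompactOperator A) (hpos : A.IsPositive) (hR : rangeProj A = 1) :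
    ∃ f : HilbertBasis ℕ ℂ H, IsEigenbasis A f (sNumbers A) ∧ Antitone (sNumbers A) ∧
      (∀ n, 0 < sNumbers A n) ∧ Tendsto (sNumbers A) atTop (𝓝 0) := by
  obtain ⟨ι, b, a, h⟩ := exists_isEigenbasis hA hpos
  obtain ⟨σ, hinj, hanti, hσ, hsurj⟩ := h.exists_enum hA (h.infinite_setOf_pos e hR)
  have hs : sNumbers A = a ∘ σ := funext (h.sNumbers_eq hA hinj hanti hσ hsurj)
  have hrange : Set.range (b ∘ σ) = Set.range b :=
    Function.Surjective.range_comp (fun i => hsurj i (h.rangeProj_eq_one_iff.mp hR i)) b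
  have ho : Orthonormal ℂ (b ∘ σ) := b.orthonormal.comp σ hinj
  have hsp : ⊤ ≤ (Submodule.span ℂ (Set.range (b ∘ σ))).topologicalClosure := by
    rw [hrange, b.dense_span]
  have hf : IsEigenbasis A (HilbertBasis.mk ho hsp) (sNumbers A) := by
    refine ⟨fun i => ?_, fun i => ?_⟩
    · rw [HilbertBasis.coe_mk, hs]
      exact h.apply_eq _
    · rw [hs]
      exact h.nonneg _
  refine ⟨_, hf, hs ▸ hanti, fun n => by rw [hs]; exact hσ n, ?_⟩
  refine (tendsto_inner_apply_orthonormal hA (HilbertBasis.mk ho hsp).orthonormal).congr fun k => ?_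
  rw [hf.inner_apply, inner_self_eq_norm_sq_to_K, (HilbertBasis.mk ho hsp).orthonormal.1]
  simp

theorem tr_eq_tsum_sNumbers (e : HilbertBasis ℕ ℂ H) {A : H →L[ℂ] H}
    (hA : IsCompactOperator A) (hpos : A.IsPositive) (hR : rangeProj A = 1) :
    tr e A = ∑' n, ENNReal.ofReal (sNumbers A n) := by
  obtain ⟨f, hf, -⟩ := exists_isEigenbasis_sNumbers e hA hpos hR
  exact hf.tr_eq e

theorem summable_sNumbers_iff (e : HilbertBasis ℕ ℂ H) {A : H →L[ℂ] H}
    (hA : IsCompactOperator A) (hpos : A.IsPositive) (hR : rangeProj A = 1) :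
    Summable (sNumbers A) ↔ tr e A < ⊤ := by
  obtain ⟨f, hf, -⟩ := exists_isEigenbasis_sNumbers e hA hpos hR
  rw [tr_eq_tsum_sNumbers e hA hpos hR]
  constructor
  · intro hs
    rw [← ENNReal.ofReal_tsum_of_nonneg hf.nonneg hs]
    exact ENNReal.ofReal_lt_top
  · intro hlt
    refine (ENNReal.summable_toReal hlt.ne).congr fun n => ?_
    rw [ENNReal.toReal_ofReal (hf.nonneg n)]

theorem majorizes_and_tr_eq_of_mem_partialIsometryOrbit (e : HilbertBasis ℕ ℂ H) {A C : H →L[ℂ] H}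
    (hA : IsCompactOperator A) (hpos : A.IsPositive) (hR : rangeProj A = 1)
    (hC : C ∈ partialIsometryOrbit A) (hRB : rangeProj (expect e C) = 1) :
    expect e C ∈ posCompact ∧ Majorizes (sNumbers (expect e C)) (sNumbers A) ∧
      tr e (expect e C) = tr e A := by
  obtain ⟨V, -, hV, rfl⟩ := hC
  rw [supportProj_eq_rangeProj hpos] at hV
  have hVn : ∀ x, ‖V x‖ = ‖x‖ := fun x => by
    rw [norm_apply_of_star_mul_self_eq hV]
    change ‖rangeProj A x‖ = ‖x‖
    rw [hR, one_apply_eq_self]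
  have hCpos := isPositive_conj hpos V
  have hBe := isEigenbasis_expect e hCpos
  have hBc := isCompactOperator_expect e (isCompactOperator_conj hA V) hCpos
  obtain ⟨f, hf, hanti, hfpos, -⟩ := exists_isEigenbasis_sNumbers e hA hpos hR
  obtain ⟨τ, hinj, hτanti, hτ, hsurj⟩ := hBe.exists_enum hBc (hBe.infinite_setOf_pos e hRB)
  refine ⟨⟨hBc, hBe.isPositive⟩, fun n => ?_, ?_⟩
  · have h1 := hf.sum_re_inner_conj_le (σ := id) Function.injective_id hanti hfpos
      (fun i _ => ⟨i, rfl⟩) (fun x => (hVn x).le) (e.orthonormal.comp τ hinj) n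
    have h2 : ∑ k ∈ Finset.range n, ‖star V ((e ∘ τ) k)‖ ^ 2 ≤ n := by
      have h3 : ∀ k ∈ Finset.range n, ‖star V ((e ∘ τ) k)‖ ^ 2 ≤ 1 := fun k _ => by
        have h4 := norm_star_apply_le (fun x => (hVn x).le) ((e ∘ τ) k)
        rw [Function.comp_apply, e.orthonormal.1] at h4
        exact pow_le_one₀ (norm_nonneg _) h4
      simpa using Finset.sum_le_card_nsmul _ _ _ h3
    have h5 : 0 ≤ sNumbers A (id n) *
        (n - ∑ k ∈ Finset.range n, ‖star V ((e ∘ τ) k)‖ ^ 2) :=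
      mul_nonneg (hfpos _).le (sub_nonneg.mpr h2)
    have h6 : ∑ k ∈ Finset.range n, sNumbers (expect e (V * A * star V)) k =
        ∑ k ∈ Finset.range n, (inner ℂ ((e ∘ τ) k) ((V * A * star V) ((e ∘ τ) k))).re :=
      Finset.sum_congr rfl fun k _ => hBe.sNumbers_eq hBc hinj hτanti hτ hsurj k
    rw [h6]
    simp only [id] at h1 h5
    linarith
  · rw [hBe.tr_eq e, hf.tr_eq e, hf.tsum_re_inner_conj e V]
    refine tsum_congr fun i => ?_
    rw [hVn, f.orthonormal.1, one_pow, mul_one]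

theorem mem_expect_image_unitaryOrbit (e : HilbertBasis ℕ ℂ H) {A B : H →L[ℂ] H}
    (hA : IsCompactOperator A) (hpos : A.IsPositive) (hR : rangeProj A = 1)
    (hBd : B ∈ diagonalOps e) (hB : B ∈ posCompact) (hRB : rangeProj B = 1)
    (hmaj : Majorizes (sNumbers B) (sNumbers A))
    (hclose : ¬ Summable (sNumbers B) ∨ ∀ ε : ℝ, 0 < ε → ∀ M, ∃ n, M ≤ n ∧
      ∑ j ∈ Finset.range n, (sNumbers A j - sNumbers B j) < ε) :
    B ∈ expect e '' unitaryOrbit A := by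
  obtain ⟨f, hf, -, hfpos, hflim⟩ := exists_isEigenbasis_sNumbers e hA hpos hR
  obtain ⟨-, hBe', hBanti, hBpos, hBlim⟩ := exists_isEigenbasis_sNumbers e hB.1 hB.2 hRB
  have hBe := isEigenbasis_of_mem_diagonalOps hBd hB.2
  obtain ⟨τ, hinj, hτanti, hτ, hsurj⟩ := hBe.exists_enum hB.1 (hBe.infinite_setOf_pos e hRB)
  have hs := hBe.sNumbers_eq hB.1 hinj hτanti hτ hsurj
  -- Only the order in which the eigenvalues enter the recursion changes; the eigenvectors still
  -- span.
  obtain ⟨π, hπmaj, hπclose⟩ : ∃ π : Equiv.Perm ℕ, Majorizes (sNumbers B) (sNumbers A ∘ π) ∧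
      ∀ ε : ℝ, 0 < ε → ∀ M, ∃ n, M ≤ n ∧
        ∑ j ∈ Finset.range n, ((sNumbers A ∘ π) j - sNumbers B j) < ε := by
    rcases hclose with hns | hclose
    · exact exists_rearrangement hf.nonneg hflim hBanti (fun j => (hBpos j).le) hBlim hns hmaj
    · exact ⟨1, hmaj, hclose⟩
  have hrange : Set.range (f ∘ π) = Set.range f := π.surjective.range_comp f
  obtain ⟨g, hg⟩ := exists_hilbertBasis_diagonal hpos (f.orthonormal.comp π π.injective)
    (by rw [hrange, f.dense_span]) (a := sNumbers A ∘ π) (fun j => hf.apply_eq (π j))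
    (fun j => hfpos _) (hflim.comp π.injective.nat_tendsto_atTop) hBanti hBpos hBlim hπmaj hπclose
  have hτsurj : Function.Surjective τ := fun i => hsurj i (hBe.rangeProj_eq_one_iff.mp hRB i)
  have hτo : Orthonormal ℂ (e ∘ τ) := e.orthonormal.comp τ hinj
  have hτsp : ⊤ ≤ (Submodule.span ℂ (Set.range (e ∘ τ))).topologicalClosure := by
    rw [hτsurj.range_comp, e.dense_span]
  obtain ⟨U, hU, hUg⟩ := exists_unitary_apply_eq g (HilbertBasis.mk hτo hτsp)
  refine ⟨U * A * star U, ⟨U, hU, rfl⟩, eq_expect_of_inner_eq hBd fun k => ?_⟩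
  obtain ⟨j, rfl⟩ := hτsurj k
  have h1 := hUg j
  rw [HilbertBasis.coe_mk, Function.comp_apply] at h1
  rw [inner_conj_apply, h1, hg, hs, ofReal_re_inner_apply hB.2]

theorem stronglyMajorizes_of_tsum_eq {ξ η : ℕ → ℝ} (h : Majorizes ξ η) (hξ : Summable ξ)
    (hη : Summable η) (heq : ∑' n, ξ n = ∑' n, η n) : StronglyMajorizes ξ η := by
  refine ⟨h, Tendsto.liminf_eq ?_⟩
  have h1 := (hη.sub hξ).hasSum.tendsto_sum_nat
  rw [hη.tsum_sub hξ, heq, sub_self] at h1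
  exact (continuous_coe_real_ereal.tendsto 0).comp h1

theorem StronglyMajorizes.exists_sum_lt {ξ η : ℕ → ℝ} (h : StronglyMajorizes ξ η) {ε : ℝ}
    (hε : 0 < ε) (M : ℕ) : ∃ n, M ≤ n ∧ ∑ j ∈ Finset.range n, (η j - ξ j) < ε := by
  have h1 : Filter.liminf (fun n : ℕ => ((∑ j ∈ Finset.range n, (η j - ξ j) : ℝ) : EReal))
      Filter.atTop < (ε : EReal) := by
    rw [h.2]
    exact_mod_cast hε
  obtain ⟨n, hn, hlt⟩ := (frequently_atTop.mp (frequently_lt_of_liminf_lt (by isBoundedDefault) h1)) M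
  exact ⟨n, hn, by exact_mod_cast hlt⟩

theorem stronglyMajorizes_sNumbers (e : HilbertBasis ℕ ℂ H) {A B : H →L[ℂ] H}
    (hA : IsCompactOperator A) (hpos : A.IsPositive) (hR : rangeProj A = 1)
    (hB : B ∈ posCompact) (hRB : rangeProj B = 1)
    (hmaj : Majorizes (sNumbers B) (sNumbers A)) (htr : tr e B = tr e A) (hfin : tr e A < ⊤) :
    StronglyMajorizes (sNumbers B) (sNumbers A) := by
  have hsA := (summable_sNumbers_iff e hA hpos hR).mpr hfin
  have hsB := (summable_sNumbers_iff e hB.1 hB.2 hRB).mpr (htr ▸ hfin)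
  refine stronglyMajorizes_of_tsum_eq hmaj hsB hsA ?_
  obtain ⟨f, hf, -⟩ := exists_isEigenbasis_sNumbers e hA hpos hR
  obtain ⟨g, hg, -⟩ := exists_isEigenbasis_sNumbers e hB.1 hB.2 hRB
  rw [tr_eq_tsum_sNumbers e hB.1 hB.2 hRB, tr_eq_tsum_sNumbers e hA hpos hR,
    ← ENNReal.ofReal_tsum_of_nonneg hf.nonneg hsA, ← ENNReal.ofReal_tsum_of_nonneg hg.nonneg hsB,
    ENNReal.ofReal_eq_ofReal_iff (tsum_nonneg hg.nonneg) (tsum_nonneg hf.nonneg)] at htr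
  exact htr

theorem tr_abs_eq (e : HilbertBasis ℕ ℂ H) {B : H →L[ℂ] H} (hB : B ∈ posCompact) :
    tr e (CFC.abs B) = tr e B := by
  obtain ⟨ι, b, a, h⟩ := exists_isEigenbasis hB.1 hB.2
  rw [h.abs_eq]

/-- Infinite trace of `B` means nonsummable s-numbers, the rearrangement case; a common finite trace
gives strong majorization. -/
theorem mem_expect_image_unitaryOrbit_of_tr (e : HilbertBasis ℕ ℂ H) {A : H →L[ℂ] H}
    (hA : IsCompactOperator A) (hpos : A.IsPositive) (hR : rangeProj A = 1) {B : H →L[ℂ] H}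
    (hBd : B ∈ diagonalOps e) (hB : B ∈ posCompact) (hRB : rangeProj B = 1)
    (hmaj : Majorizes (sNumbers B) (sNumbers A)) (htr : tr e B = tr e A ∨ tr e B = ⊤) :
    B ∈ expect e '' unitaryOrbit A := by
  refine mem_expect_image_unitaryOrbit e hA hpos hR hBd hB hRB hmaj ?_
  rw [summable_sNumbers_iff e hB.1 hB.2 hRB, not_lt_top_iff]
  refine or_iff_not_imp_left.mpr fun hne => ?_
  have heq := htr.resolve_right hne
  have h1 := stronglyMajorizes_sNumbers e hA hpos hR hB hRB hmaj heq
    (heq ▸ lt_top_iff_ne_top.mpr hne)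
  exact fun ε hε M => h1.exists_sum_lt hε M

theorem exists_partialIsometry_apply_eq (e : HilbertBasis ℕ ℂ H) {A : H →L[ℂ] H}
    (hpos : A.IsPositive) {f : ℕ → H} (hf : Orthonormal ℂ f)
    (hfmem : ∀ n, f n ∈ LinearMap.range (A : H →ₗ[ℂ] H))
    (hker : ∀ x, (∀ n, (inner ℂ (f n) x : ℂ) = 0) → A x = 0) :
    ∃ V : H →L[ℂ] H, star V * V = rangeProj A ∧ ∀ n, star V (e n) = f n := by
  classical
  -- The adjoint of the required `V`: it maps `H` isometrically onto the closed span of the `f n`,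
  -- which is the closure of the range of `A`.
  let W : H →ₗᵢ[ℂ] H := hf.orthogonalFamily.linearIsometry.comp e.repr.toLinearIsometry
  have hW : ∀ n, W (e n) = f n := by
    intro n
    change hf.orthogonalFamily.linearIsometry (e.repr (e n)) = f n
    rw [e.repr_self, OrthogonalFamily.linearIsometry_apply_single]
    simp
  set V : H →L[ℂ] H := star W.toContinuousLinearMap with hV
  have hVW : star V = W.toContinuousLinearMap := star_star _
  refine ⟨V, ?_, fun n => by rw [hVW]; exact hW n⟩
  have hmem : ∀ x, W x ∈ (LinearMap.range (A : H →ₗ[ℂ] H)).topologicalClosure := by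
    intro x
    have h1 := (e.hasSum_repr x).mapL W.toContinuousLinearMap
    refine (Submodule.isClosed_topologicalClosure _).mem_of_tendsto h1
      (Eventually.of_forall fun s => Submodule.sum_mem _ fun n _ => ?_)
    rw [map_smul]
    refine Submodule.smul_mem _ _ (Submodule.le_topologicalClosure _ ?_)
    have h2 := hfmem n
    rwa [← hW n] at h2
  ext x
  refine (Submodule.eq_starProjection_of_mem_orthogonal (hVW ▸ hmem (V x)) ?_).symm
  rw [mem_orthogonal_range_iff hpos]
  refine hker _ fun n => ?_
  have h3 : (inner ℂ (f n) (W (V x)) : ℂ) = inner ℂ (f n) x := by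
    rw [← hW n, W.inner_map_map, hV, ContinuousLinearMap.star_eq_adjoint,
      ContinuousLinearMap.adjoint_inner_right]
    rfl
  rw [inner_sub_right, hVW]
  change _ - (inner ℂ (f n) (W (V x)) : ℂ) = 0
  rw [h3, sub_self]

/-- Equality in Schur's inequality, with a positive threshold `a (σ (k + 1))`, forces the defect to
vanish. So each `star U (e k)` keeps its norm under the range projection, hence lies in the closed
range of `A`; these vectors form a basis. -/
theorem rangeProj_eq_one_of_expect_unitary {ι : Type*} (e : HilbertBasis ℕ ℂ H) {A : H →L[ℂ] H}
    {b : HilbertBasis ι ℂ H} {a : ι → ℝ} (h : IsEigenbasis A b a) {σ : ℕ → ι}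
    (hinj : Function.Injective σ) (hanti : Antitone (a ∘ σ)) (hpos : ∀ k, 0 < a (σ k))
    (hsurj : ∀ i, 0 < a i → i ∈ Set.range σ) {U : H →L[ℂ] H} (hU : U ∈ unitary (H →L[ℂ] H))
    (hdiag : ∀ k, (inner ℂ (e k) ((U * A * star U) (e k)) : ℂ).re = a (σ k)) :
    rangeProj A = 1 := by
  set V := U * rangeProj A with hV
  have hVn : ∀ x, ‖V x‖ ≤ ‖x‖ := fun x => by
    rw [hV, mul_apply_eq_comp, norm_apply_of_mem_unitary hU]
    exact Submodule.norm_starProjection_apply_le _ x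
  have hVs : ∀ x, star V x = rangeProj A (star U x) := fun x => by
    rw [hV, star_mul, star_rangeProj, mul_apply_eq_comp]
  have hle : ∀ k, ‖star V (e k)‖ ^ 2 ≤ 1 := fun k => by
    have h4 := norm_star_apply_le hVn (e k)
    rw [e.orthonormal.1] at h4
    exact pow_le_one₀ (norm_nonneg _) h4
  have hone : ∀ k, ‖star V (e k)‖ ^ 2 = 1 := by
    intro k
    have h1 := h.sum_re_inner_conj_le hinj hanti hpos hsurj hVn e.orthonormal (k + 1)
    rw [hV, conj_mul_rangeProj h.isPositive, ← hV] at h1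
    simp only [hdiag] at h1
    have h2 : ((k + 1 : ℕ) : ℝ) - ∑ j ∈ Finset.range (k + 1), ‖star V (e j)‖ ^ 2 ≤ 0 := by
      by_contra hcon
      linarith [mul_pos (hpos (k + 1)) (not_le.mp hcon)]
    have h3 : ∑ j ∈ Finset.range k, ‖star V (e j)‖ ^ 2 ≤ k := by
      simpa using Finset.sum_le_card_nsmul (Finset.range k) _ _ fun j _ => hle j
    rw [Finset.sum_range_succ] at h2
    push_cast at h2
    linarith [hle k]
  have hfix : ∀ k, rangeProj A (star U (e k)) = star U (e k) := by
    intro k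
    have h1 : ‖star U (e k)‖ = 1 := by
      rw [norm_apply_of_mem_unitary (Unitary.star_mem hU), e.orthonormal.1]
    have h2 : ‖rangeProj A (star U (e k))‖ = 1 := by
      rw [← hVs]
      exact (pow_eq_one_iff_of_nonneg (norm_nonneg _) two_ne_zero).mp (hone k)
    refine Submodule.starProjection_eq_self_iff.mpr ?_
    exact (Submodule.mem_iff_norm_starProjection _ _).mpr (h2.trans h1.symm)
  have hUP : U * rangeProj A * star U = 1 := by
    refine ContinuousLinearMap.ext_on (s := Set.range e)
      (Submodule.dense_iff_topologicalClosure_eq_top.mpr e.dense_span) ?_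
    rintro _ ⟨k, rfl⟩
    rw [mul_apply_eq_comp, mul_apply_eq_comp, hfix, apply_star_apply_of_mem_unitary hU,
      one_apply_eq_self]
  calc rangeProj A = star U * (U * rangeProj A * star U) * U := by
        rw [← mul_assoc, ← mul_assoc, (Unitary.mem_iff.mp hU).1, one_mul, mul_assoc,
          (Unitary.mem_iff.mp hU).1, mul_one]
    _ = 1 := by rw [hUP, mul_one, (Unitary.mem_iff.mp hU).1]

/-- For an operator of infinite rank without dense range, the diagonal operator of its nonzero
eigenvalues is the diagonal of a partial isometric conjugate, but not of a unitary one. -/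
theorem exists_mem_partialIsometryOrbit_notMem_unitaryOrbit (e : HilbertBasis ℕ ℂ H)
    {A : H →L[ℂ] H} (hA : IsCompactOperator A) (hpos : A.IsPositive) (hR : rangeProj A ≠ 1)
    (hinf : ¬ FiniteDimensional ℂ (LinearMap.range (A : H →ₗ[ℂ] H))) :
    ∃ B ∈ expect e '' partialIsometryOrbit A, rangeProj B = 1 ∧
      B ∉ expect e '' unitaryOrbit A := by
  obtain ⟨ι, b, a, h⟩ := exists_isEigenbasis hA hpos
  obtain ⟨σ, hinj, hanti, hσ, hsurj⟩ := h.exists_enum hA fun hfin =>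
    hinf (h.finiteDimensional_range hfin)
  obtain ⟨V, hV, hVe⟩ := exists_partialIsometry_apply_eq e hpos (b.orthonormal.comp σ hinj)
    (fun n => ⟨((a (σ n) : ℂ)⁻¹) • b (σ n), by
      rw [ContinuousLinearMap.coe_coe, map_smul, h.apply_eq, smul_smul,
        inv_mul_cancel₀ (by exact_mod_cast (hσ n).ne'), one_smul]
      rfl⟩)
    (fun x hx => (h.apply_eq_zero_iff x).mpr fun i hi => by
      obtain ⟨n, rfl⟩ := hsurj i hi
      exact hx n)
  have hd : ∀ k, (inner ℂ (e k) ((V * A * star V) (e k)) : ℂ).re = a (σ k) := fun k => by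
    rw [inner_conj_apply, hVe, Function.comp_apply, h.inner_apply, inner_self_eq_norm_sq_to_K,
      b.orthonormal.1]
    simp
  have hBe := isEigenbasis_expect e (isPositive_conj hpos V)
  refine ⟨expect e (V * A * star V), ⟨_, ⟨V, mul_star_mul_self_of_rangeProj hV,
    by rw [hV, supportProj_eq_rangeProj hpos], rfl⟩, rfl⟩,
    hBe.rangeProj_eq_one_iff.mpr fun k => (hd k).symm ▸ hσ k, ?_⟩
  rintro ⟨_, ⟨U, hU, rfl⟩, hUB⟩
  refine hR (rangeProj_eq_one_of_expect_unitary e h hinj hanti hσ hsurj hU fun k => ?_)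
  rw [← inner_expect_self, hUB, inner_expect_self, hd]

end Majorization

end SchurHorn

/-! ### Assembly of the three statements -/

theorem proposition6p6 {H : Type*} [NormedAddCommGroup H] [InnerProductSpace ℂ H]
    [CompleteSpace H] (e : HilbertBasis ℕ ℂ H) (A : H →L[ℂ] H)
    (hA_compact : IsCompactOperator A) (hA_pos : A.IsPositive) :
    -- (i)
    (SchurHorn.expect e '' SchurHorn.unitaryOrbit A ⊆
      SchurHorn.expect e '' SchurHorn.partialIsometryOrbit A ∩
        {B | B ∈ SchurHorn.diagonalOps e ∧
          SchurHorn.tr e (1 - SchurHorn.rangeProj B) ≤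
            SchurHorn.tr e (1 - SchurHorn.rangeProj A)}) ∧
    -- (ii)
    (SchurHorn.rangeProj A = 1 →
      SchurHorn.expect e '' SchurHorn.unitaryOrbit A =
        SchurHorn.expect e '' SchurHorn.partialIsometryOrbit A ∩
          {B | B ∈ SchurHorn.diagonalOps e ∧ SchurHorn.rangeProj B = 1} ∧
      (SchurHorn.tr e A = ⊤ →
        SchurHorn.expect e '' SchurHorn.unitaryOrbit A =
          {B | B ∈ SchurHorn.diagonalOps e ∩ SchurHorn.posCompact ∧
            SchurHorn.Majorizes (SchurHorn.sNumbers B) (SchurHorn.sNumbers A) ∧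
            SchurHorn.rangeProj B = 1} \ SchurHorn.traceClass e) ∧
      (SchurHorn.tr e A < ⊤ →
        SchurHorn.expect e '' SchurHorn.unitaryOrbit A =
          {B | B ∈ SchurHorn.diagonalOps e ∩ SchurHorn.posCompact ∧
            SchurHorn.StronglyMajorizes (SchurHorn.sNumbers B) (SchurHorn.sNumbers A) ∧
            SchurHorn.rangeProj B = 1})) ∧
    -- (iii)
    (SchurHorn.expect e '' SchurHorn.unitaryOrbit A ⊂
      SchurHorn.expect e '' SchurHorn.partialIsometryOrbit A ∩
        {B | B ∈ SchurHorn.diagonalOps e ∧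
          SchurHorn.tr e (1 - SchurHorn.rangeProj B) ≤
            SchurHorn.tr e (1 - SchurHorn.rangeProj A)} ↔
      ¬ (SchurHorn.rangeProj A = 1 ∨
        FiniteDimensional ℂ (LinearMap.range (A : H →ₗ[ℂ] H)))) := by
  have hsub : SchurHorn.expect e '' SchurHorn.unitaryOrbit A ⊆ SchurHorn.expect e '' SchurHorn.partialIsometryOrbit A ∩
      {B | B ∈ SchurHorn.diagonalOps e ∧ SchurHorn.tr e (1 - SchurHorn.rangeProj B) ≤ SchurHorn.tr e (1 - SchurHorn.rangeProj A)} := by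
    rintro _ ⟨C, hC, rfl⟩
    exact ⟨⟨C, SchurHorn.unitaryOrbit_subset_partialIsometryOrbit hA_pos hC, rfl⟩,
      SchurHorn.expect_mem_diagonalOps e C, SchurHorn.tr_one_sub_rangeProj_expect_le e hA_compact hA_pos hC⟩
  -- If `R_A = 1`, the trace bound in (i) leaves no kernel, so the right-hand sides of (i) and (ii)
  -- coincide.
  have hRB : ∀ C : H →L[ℂ] H, C ∈ SchurHorn.partialIsometryOrbit A → SchurHorn.rangeProj A = 1 →
      SchurHorn.tr e (1 - SchurHorn.rangeProj (SchurHorn.expect e C)) ≤ SchurHorn.tr e (1 - SchurHorn.rangeProj A) →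
      SchurHorn.rangeProj (SchurHorn.expect e C) = 1 := by
    rintro C ⟨V, -, -, rfl⟩ hR hle
    exact SchurHorn.rangeProj_eq_one_of_tr_le e (SchurHorn.isEigenbasis_expect e (SchurHorn.isPositive_conj hA_pos V)) hR hle
  have hback : ∀ C : H →L[ℂ] H, C ∈ SchurHorn.partialIsometryOrbit A → SchurHorn.rangeProj A = 1 →
      SchurHorn.rangeProj (SchurHorn.expect e C) = 1 → SchurHorn.expect e C ∈ SchurHorn.expect e '' SchurHorn.unitaryOrbit A := by
    intro C hC hR hRC
    obtain ⟨h1, h2, h3⟩ :=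
      SchurHorn.majorizes_and_tr_eq_of_mem_partialIsometryOrbit e hA_compact hA_pos hR hC hRC
    exact SchurHorn.mem_expect_image_unitaryOrbit_of_tr e hA_compact hA_pos hR (SchurHorn.expect_mem_diagonalOps e C)
      h1 hRC h2 (Or.inl h3)
  have hfwd : ∀ C : H →L[ℂ] H, C ∈ SchurHorn.unitaryOrbit A → SchurHorn.rangeProj A = 1 →
      SchurHorn.rangeProj (SchurHorn.expect e C) = 1 ∧ SchurHorn.expect e C ∈ SchurHorn.posCompact ∧
      SchurHorn.Majorizes (SchurHorn.sNumbers (SchurHorn.expect e C)) (SchurHorn.sNumbers A) ∧ SchurHorn.tr e (SchurHorn.expect e C) = SchurHorn.tr e A := by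
    intro C hC hR
    have hC' := SchurHorn.unitaryOrbit_subset_partialIsometryOrbit hA_pos hC
    have hRC := hRB C hC' hR (hsub ⟨C, hC, rfl⟩).2.2
    exact ⟨hRC, SchurHorn.majorizes_and_tr_eq_of_mem_partialIsometryOrbit e hA_compact hA_pos hR hC' hRC⟩
  refine ⟨hsub, fun hR => ⟨?_, fun htr => ?_, fun htr => ?_⟩, ?_⟩
  · refine Set.Subset.antisymm ?_ ?_
    · rintro _ ⟨C, hC, rfl⟩
      exact ⟨(hsub ⟨C, hC, rfl⟩).1, SchurHorn.expect_mem_diagonalOps e C, (hfwd C hC hR).1⟩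
    · rintro _ ⟨⟨C, hC, rfl⟩, -, hRC⟩
      exact hback C hC hR hRC
  · refine Set.Subset.antisymm ?_ ?_
    · rintro _ ⟨C, hC, rfl⟩
      obtain ⟨h1, h2, h3, h4⟩ := hfwd C hC hR
      refine ⟨⟨⟨SchurHorn.expect_mem_diagonalOps e C, h2⟩, h3, h1⟩, fun h5 => ?_⟩
      have h6 : SchurHorn.tr e (CFC.abs (SchurHorn.expect e C)) < ⊤ := h5
      rw [SchurHorn.tr_abs_eq e h2, h4, htr] at h6
      exact lt_irrefl _ h6
    · rintro B ⟨⟨⟨hBd, hB⟩, hmaj, hRB⟩, hnt⟩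
      refine SchurHorn.mem_expect_image_unitaryOrbit_of_tr e hA_compact hA_pos hR hBd hB hRB hmaj (Or.inr ?_)
      have h6 : ¬ SchurHorn.tr e (CFC.abs B) < ⊤ := hnt
      rwa [SchurHorn.tr_abs_eq e hB, not_lt_top_iff] at h6
  · refine Set.Subset.antisymm ?_ ?_
    · rintro _ ⟨C, hC, rfl⟩
      obtain ⟨h1, h2, h3, h4⟩ := hfwd C hC hR
      exact ⟨⟨SchurHorn.expect_mem_diagonalOps e C, h2⟩,
        SchurHorn.stronglyMajorizes_sNumbers e hA_compact hA_pos hR h2 h1 h3 h4 htr, h1⟩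
    · rintro B ⟨⟨hBd, hB⟩, hmaj, hRB⟩
      exact SchurHorn.mem_expect_image_unitaryOrbit e hA_compact hA_pos hR hBd hB hRB hmaj.1
        (Or.inr fun ε hε M => hmaj.exists_sum_lt hε M)
  · constructor
    · rintro hss (hR | hfin)
      · refine hss.2 ?_
        rintro _ ⟨⟨C, hC, rfl⟩, -, hle⟩
        exact hback C hC hR (hRB C hC hR hle)
      · refine hss.2 ?_
        rintro _ ⟨⟨C, hC, rfl⟩, -⟩
        exact ⟨C, SchurHorn.partialIsometryOrbit_subset_unitaryOrbit hA_pos hfin hC, rfl⟩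
    · intro hne
      rw [not_or] at hne
      obtain ⟨_, ⟨C, hC, rfl⟩, h1, h2⟩ := SchurHorn.exists_mem_partialIsometryOrbit_notMem_unitaryOrbit e
        hA_compact hA_pos hne.1 hne.2
      refine ⟨hsub, fun hsup => h2 (hsup ⟨⟨C, hC, rfl⟩, SchurHorn.expect_mem_diagonalOps e C, ?_⟩)⟩
      -- The separating operator has dense range, so its side of the trace bound is zero.
      rw [h1, sub_self, SchurHorn.tr_zero]
      exact zero_le
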